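/- Let $D\subset\mathbb R^d$ be a nonempty bounded open set, let $|v|_{H^1(D)}=\|\nabla v\|_{L^2(D)}$ be the norm on $H^1_0(D)$, and let $H^{-1}(D)$ be its dual with the dual norm. Let $k^*,m_0,\phi_1,\phi_2,\ldots\in C(\overline D)$ with $k^*>0$ on $\overline D$, let $\gamma_j\ge 0$, and put $k^*_{\min}=\min_{\overline D}k^*>0$ and $b_j=\gamma_j\|\phi_j\|_{C^0(\overline D)}$. For $J\ge 0$ and $\xi\in\mathbb R^J$ let $$k(x;\xi)=k^*(x)+\exp\Big(m_0(x)+\sum_{j=1}^J\gamma_j\xi_j\phi_j(x)\Big),\qquad k_{\min}(\xi)=\min_{x\in\overline D}k(x;\xi)\ \ (\ge k^*_{\min}).$$ Let $f\in H^{-1}(D)$, let $\mathcal T_h$ be a finite simplicial triangulation of $\overline D$, let $V_h\subset H^1_0(D)$ be the space of continuous functions on $\overline D$ that are affine on every simplex of $\mathcal T_h$ and vanish on $\partial D$, and let $p_h^J(\cdot;\xi)\in V_h$ be the finite element solution: $$\int_D k(x;\xi)\,\nabla p_h^J(x;\xi)\cdot\nabla q(x)\,dx=\langle f,q\rangle\quad\text{for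 all } q\in V_h .$$ Let $\mathcal H:H^1_0(D)\to\mathbb R$ be a bounded linear functional, $y\in\mathbb R$, $\sigma_\eta>0$, and $$\theta(\zeta)=\exp\Big(-\frac{|y-\mathcal H(\zeta)|^2}{2\sigma_\eta^2}\Big),\qquad \kappa_*=\frac{\|\mathcal H\|_{H^{-1}(D)}\|f\|_{H^{-1}(D)}}{k^*_{\min}}.$$ Then for every $\kappa_0>0$ there is a constant $c_p>1$, depending only on $\kappa_0$, such that for all data as above with $\kappa_*\ge\kappa_0$ the following holds with $$c_1=\frac{c_p\max\{\kappa_*,\kappa_*^2\}}{\ln 2}>0 .$$ There is a constant $C>0$, independent of $J$, $\boldsymbol\nu$, $\xi$ and of the triangulation, such that for all $J$ the function $\xi\mapsto\theta(p_h^J(\cdot;\xi))$ is $C^\infty$ on $\mathbb R^J$, and for all $\boldsymbol\nu\in\{0,1\}^J$ and $\xi\in\mathbb R^J$ $$\left|\frac{\partial^{|\boldsymbol\nu|}\theta(p_h^J)}{\partial\xi^{\boldsymbol\nu}}(\xi)\right|\le C\,\frac{c_1^{|\boldsymbol\nu|}\,|\boldsymbol\nu|!}{k^*_{\min}}\prod_{j=1}^J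 b_j^{\nu_j};$$ moreover, for $\boldsymbol\nu\ne\boldsymbol 0$ the same bound holds with $k^*_{\min}$ replaced by $k_{\min}(\xi)$. (In particular, for given data with $\kappa_*>0$ there is a constant $c_p>1$, depending only on $\kappa_*$, with these properties, and for $\kappa_*\ge1$ the constant $c_p$ can be chosen absolute.) -/

import Mathlib

open MeasureTheory Set

open scoped ContDiff Gradient

namespace BayesFE

noncomputable section

/-- Euclidean space of dimension `d`. -/
abbrev E (d : ℕ) := EuclideanSpace ℝ (Fin d)

/-- The pairs `(v, ∇v)` in `L²(D) × L²(D; ℝᵈ)` with `v` a test function on `D`. -/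
def testPairs {d : ℕ} (D : Set (E d)) :
    Submodule ℝ (Lp ℝ 2 (volume.restrict D) × Lp (E d) 2 (volume.restrict D)) where
  carrier := {v | ∃ φ : E d → ℝ, ContDiff ℝ ∞ φ ∧ HasCompactSupport φ ∧ tsupport φ ⊆ D ∧
    v.1 =ᵐ[volume.restrict D] φ ∧ v.2 =ᵐ[volume.restrict D] ∇ φ}
  add_mem' := by
    rintro v w ⟨φ, h1, h2, h3, h4, h5⟩ ⟨χ, g1, g2, g3, g4, g5⟩
    refine ⟨φ + χ, h1.add g1, h2.add g2,
      (tsupport_add φ χ).trans (union_subset h3 g3), ?_, ?_⟩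
    · exact (Lp.coeFn_add v.1 w.1).trans (h4.add g4)
    · have e : ∇ (φ + χ) = ∇ φ + ∇ χ := by
        ext1 x
        simp only [gradient, Pi.add_apply]
        rw [fderiv_add (h1.differentiable (by simp) x) (g1.differentiable (by simp) x), map_add]
      rw [e]
      exact (Lp.coeFn_add v.2 w.2).trans (h5.add g5)
  zero_mem' := by
    refine ⟨0, contDiff_const, HasCompactSupport.zero, by simp [tsupport], ?_, ?_⟩
    · exact Lp.coeFn_zero _ _ _
    · have e : ∇ (0 : E d → ℝ) = 0 := by
        ext1 x
        simp [gradient]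
      rw [e]
      exact Lp.coeFn_zero _ _ _
  smul_mem' := by
    rintro c v ⟨φ, h1, h2, h3, h4, h5⟩
    refine ⟨c • φ, h1.const_smul c, h2.smul_left (f := fun _ => c),
      (closure_mono (Function.support_const_smul_subset c φ)).trans h3, ?_, ?_⟩
    · exact (Lp.coeFn_smul c v.1).trans (h4.const_smul c)
    · have e : ∇ (c • φ) = c • ∇ φ := by
        ext1 x
        simp only [gradient, Pi.smul_apply]
        rw [fderiv_const_smul (h1.differentiable (by simp) x), map_smul]
      rw [e]
      exact (Lp.coeFn_smul c v.2).trans (h5.const_smul c)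

/-- The Sobolev space `H¹₀(D)`: the closure of the test functions on `D` in `H¹(D)`. An element is
stored as the pair of the function and its weak gradient; the norm on the product
`L²(D) × L²(D; ℝᵈ)` is equivalent to the full `H¹(D)` norm. -/
def H10 {d : ℕ} (D : Set (E d)) : Type := (testPairs D).topologicalClosure

namespace H10

variable {d : ℕ} {D : Set (E d)}

instance : AddCommGroup (H10 D) := inferInstanceAs (AddCommGroup (testPairs D).topologicalClosure)

instance : Module ℝ (H10 D) := inferInstanceAs (Module ℝ (testPairs D).topologicalClosure)

/-- The underlying `L²` function. -/
def toL2 : H10 D →ₗ[ℝ] Lp ℝ 2 (volume.restrict D) :=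
  (LinearMap.fst ℝ _ _).comp (testPairs D).topologicalClosure.subtype

/-- The weak gradient. -/
def grad : H10 D →ₗ[ℝ] Lp (E d) 2 (volume.restrict D) :=
  (LinearMap.snd ℝ _ _).comp (testPairs D).topologicalClosure.subtype

/-- `H¹₀(D)` carries the norm `|v|_{H¹(D)} = ‖∇v‖_{L²(D)}` (for bounded `D` equivalent to the full
`H¹(D)` norm). Accordingly `StrongDual ℝ (H10 D)` is `H⁻¹(D)` with the norm
`sup |F v| / |v|_{H¹(D)}`. -/
instance : SeminormedAddCommGroup (H10 D) := SeminormedAddCommGroup.induced _ _ (grad (D := D))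

instance : NormedSpace ℝ (H10 D) := NormedSpace.induced ℝ _ _ (grad (D := D))

end H10

variable {d : ℕ} {D : Set (E d)}

/-- The bilinear form `b(v, w) = ∫_D k ∇v · ∇w dx`. -/
def bform (k : E d → ℝ) (v w : H10 D) : ℝ :=
  ∫ x in D, k x * inner ℝ (H10.grad v x) (H10.grad w x)

/-- `K` is a simplicial triangulation of `closure D`. -/
def IsTriangulation (D : Set (E d)) (K : Geometry.SimplicialComplex ℝ (E d)) : Prop :=
  K.faces.Finite ∧ K.space = closure D

/-- The finite element space of the continuous functions on `closure D` which are affine on every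
simplex of `K` and vanish on the boundary of `D`. -/
def feSpace (D : Set (E d)) (K : Geometry.SimplicialComplex ℝ (E d)) : Submodule ℝ (H10 D) where
  carrier := {v | ∃ q : E d → ℝ, ContinuousOn q (closure D) ∧
    (∀ s ∈ K.faces, ∃ A : E d →ᵃ[ℝ] ℝ, EqOn q A (convexHull ℝ (s : Set (E d)))) ∧
    (∀ x ∈ frontier D, q x = 0) ∧ H10.toL2 v =ᵐ[volume.restrict D] q}
  add_mem' := by
    rintro v w ⟨q, h1, h2, h3, h4⟩ ⟨r, g1, g2, g3, g4⟩
    refine ⟨q + r, h1.add g1, fun s hs => ?_, fun x hx => ?_, ?_⟩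
    · obtain ⟨A, hA⟩ := h2 s hs
      obtain ⟨B, hB⟩ := g2 s hs
      exact ⟨A + B, fun x hx => by simp [hA hx, hB hx]⟩
    · simp [h3 x hx, g3 x hx]
    · rw [map_add]
      exact (Lp.coeFn_add _ _).trans (h4.add g4)
  zero_mem' := by
    refine ⟨0, continuousOn_const, fun s _ => ⟨0, fun x _ => by simp⟩, fun x _ => rfl, ?_⟩
    rw [map_zero]
    exact Lp.coeFn_zero _ _ _
  smul_mem' := by
    rintro c v ⟨q, h1, h2, h3, h4⟩
    refine ⟨c • q, h1.const_smul c, fun s hs => ?_, fun x hx => ?_, ?_⟩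
    · obtain ⟨A, hA⟩ := h2 s hs
      exact ⟨c • A, fun x hx => by simp [hA hx]⟩
    · simp [h3 x hx]
    · rw [map_smul]
      exact (Lp.coeFn_smul _ _).trans (h4.const_smul c)

/-- `p` is the finite element approximation: `p ∈ V_h` and `b(p, q) = ⟨f, q⟩` for all `q ∈ V_h`. -/
def IsFESolution (K : Geometry.SimplicialComplex ℝ (E d)) (k : E d → ℝ)
    (f : StrongDual ℝ (H10 D)) (p : H10 D) : Prop :=
  p ∈ feSpace D K ∧ ∀ q ∈ feSpace D K, bform k p q = f q

/-- The truncated expansion `u(x; ξ) = m₀(x) + ∑_{j < J} γ_j ξ_j φ_j(x)`. -/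
def uJ (m0 : E d → ℝ) (γ : ℕ → ℝ) (φ : ℕ → E d → ℝ) {J : ℕ} (ξ : Fin J → ℝ) (x : E d) : ℝ :=
  m0 x + ∑ j : Fin J, γ j * ξ j * φ j x

/-- The coefficient `k(x; ξ) = k*(x) + exp(u(x; ξ))`. -/
def kJ (kstar m0 : E d → ℝ) (γ : ℕ → ℝ) (φ : ℕ → E d → ℝ) {J : ℕ} (ξ : Fin J → ℝ) (x : E d) : ℝ :=
  kstar x + Real.exp (uJ m0 γ φ ξ x)

/-- The minimum of `k` over `closure D`. -/
def kMin (D : Set (E d)) (k : E d → ℝ) : ℝ := sInf (k '' closure D)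

/-- The norm of `g` in `C⁰(closure D)`. -/
def supNorm (D : Set (E d)) (g : E d → ℝ) : ℝ := sSup ((fun x => |g x|) '' closure D)

/-- The likelihood `θ(ζ) = exp(-|y - H(ζ)|² / (2 σ²))` for a scalar observation operator `H`. -/
def theta {V : Type*} (H : V → ℝ) (y σ : ℝ) (ζ : V) : ℝ :=
  Real.exp (-(1 / (2 * σ ^ 2) * |y - H ζ| ^ 2))

/-- The partial derivative `∂F/∂ξ_j`. -/
def partialDeriv {J : ℕ} (j : Fin J) (F : (Fin J → ℝ) → ℝ) (ξ : Fin J → ℝ) : ℝ :=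
  lineDeriv ℝ F ξ (Pi.single j 1)

/-- The mixed partial derivative `∂^{|ν|} F / ∂ξ^ν`. -/
def mixedPartial {J : ℕ} (ν : Fin J → ℕ) (F : (Fin J → ℝ) → ℝ) : (Fin J → ℝ) → ℝ :=
  (List.finRange J).foldr (fun j G => (partialDeriv j)^[ν j] G) F

end

end BayesFE

open BayesFE

/-! Fix `ξ` and measure everything in the energy norm `N v = √(a(ξ)(v, v))` of the form `a(ξ)(v, w)
= ∫ k ∇v·∇w`. A nonempty product of parameter derivatives maps `k = k* + exp u` to `∏ γ_j φ_j · exp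
u`. Since `k* ≥ 0`, this is at most `∏ b_j · k` in absolute value, so the differentiated forms are
bounded by `∏ b_j · N v · N w`, with no other constant. Differentiating `a(ξ)(p, ·) = f` by the
Leibniz rule and testing with the highest derivative of `p` gives a recursion, whence `N(∂^l p) ≤ ∏
b_j · n! 2^n · N p` (`energy_dirDeriv_le`). Passing from `N` to the gradient norm, once for `f` and
once for `H`, costs `k_min(ξ)^(-1/2)` each time. So the derivatives of `z = H(p)` are at most `κ' ∏
b_j · n! 2^n` with `κ' = ‖H‖‖f‖ / k_min(ξ)`.

The Gaussian is entire, so Cauchy's estimate on unit circles bounds its `m`-th derivative by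
`exp(1/(2σ²)) m!`. Chain rule, Leibniz rule and induction on the number of derivatives, for all `m`
at once, bound those of `θ^(m) ∘ z` by `(m + n)! (8(1 + κ))^n`, with a factor `κ'` to spare when `n
≥ 1` (`abs_dirDeriv_comp_le`). That factor yields the local `k_min(ξ)`, and `κ ≥ κ₀` lets a multiple
of `κ` absorb `1 + κ`.

The estimates hold for Galerkin solutions in any subspace of `H¹₀(D)`, hence uniformly in the mesh.
Smoothness of `p` is that of operator inversion. -/

namespace BayesFE

noncomputable section

/-! ### Iterated directional derivatives and the Leibniz rule -/

section DirDeriv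

variable {ι V X Y Z : Type*} [NormedAddCommGroup V] [NormedSpace ℝ V]
  [NormedAddCommGroup X] [NormedSpace ℝ X] [NormedAddCommGroup Y] [NormedSpace ℝ Y]
  [NormedAddCommGroup Z] [NormedSpace ℝ Z]

/-- The iterated directional derivative along the directions `e i`, `i` in the list; the last
entry of the list is differentiated first. -/
def dirDeriv (e : ι → V) : List ι → (V → X) → V → X
  | [], F => F
  | i :: l, F => fun ξ => lineDeriv ℝ (dirDeriv e l F) ξ (e i)

@[simp] theorem dirDeriv_nil (e : ι → V) (F : V → X) : dirDeriv e [] F = F := rfl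

theorem dirDeriv_cons (e : ι → V) (i : ι) (l : List ι) (F : V → X) :
    dirDeriv e (i :: l) F = fun ξ => lineDeriv ℝ (dirDeriv e l F) ξ (e i) := rfl

theorem dirDeriv_append (e : ι → V) (l l' : List ι) (F : V → X) :
    dirDeriv e (l ++ l') F = dirDeriv e l (dirDeriv e l' F) := by
  induction l with
  | nil => rfl
  | cons i l ih => rw [List.cons_append, dirDeriv_cons, dirDeriv_cons, ih]

theorem contDiff_lineDeriv {F : V → X} (hF : ContDiff ℝ ∞ F) (v : V) :
    ContDiff ℝ ∞ fun ξ => lineDeriv ℝ F ξ v := by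
  have h : (fun ξ => lineDeriv ℝ F ξ v) = fun ξ => fderiv ℝ F ξ v := by
    funext ξ
    exact (hF.differentiable (by simp) ξ).lineDeriv_eq_fderiv
  rw [h]
  exact (hF.fderiv_right (m := ∞) (by simp)).clm_apply contDiff_const

theorem contDiff_dirDeriv (e : ι → V) (l : List ι) {F : V → X} (hF : ContDiff ℝ ∞ F) :
    ContDiff ℝ ∞ (dirDeriv e l F) := by
  induction l with
  | nil => exact hF
  | cons i l ih => exact contDiff_lineDeriv ih (e i)

theorem lineDeriv_clm_comp (L : X →L[ℝ] Y) {F : V → X} (hF : ContDiff ℝ ∞ F) (ξ v : V) :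
    lineDeriv ℝ (fun ξ => L (F ξ)) ξ v = L (lineDeriv ℝ F ξ v) := by
  have hF' := hF.differentiable (by simp) ξ
  rw [hF'.lineDeriv_eq_fderiv, DifferentiableAt.lineDeriv_eq_fderiv (by fun_prop)]
  rw [show (fun ξ => L (F ξ)) = L ∘ F from rfl, fderiv_comp ξ L.differentiableAt hF']
  simp

theorem dirDeriv_clm_comp (e : ι → V) (l : List ι) (L : X →L[ℝ] Y) {F : V → X}
    (hF : ContDiff ℝ ∞ F) :
    dirDeriv e l (fun ξ => L (F ξ)) = fun ξ => L (dirDeriv e l F ξ) := by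
  induction l with
  | nil => rfl
  | cons i l ih =>
    rw [dirDeriv_cons, ih]
    funext ξ
    exact lineDeriv_clm_comp L (contDiff_dirDeriv e l hF) ξ (e i)

theorem dirDeriv_const (e : ι → V) (l : List ι) (hl : l ≠ []) (c : X) :
    dirDeriv e l (fun _ => c) = 0 := by
  induction l with
  | nil => exact absurd rfl hl
  | cons i l ih =>
    rw [dirDeriv_cons]
    funext ξ
    rcases eq_or_ne l [] with rfl | h
    · simp [lineDeriv]
    · rw [ih h]
      simp [lineDeriv]

/-- All ways to distribute the entries of a list over two lists. -/
def splits : List ι → List (List ι × List ι)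
  | [] => [([], [])]
  | i :: l => (splits l).map (fun s => (i :: s.1, s.2)) ++ (splits l).map (fun s => (s.1, i :: s.2))

theorem length_of_mem_splits {l : List ι} {s : List ι × List ι} (hs : s ∈ splits l) :
    s.1.length + s.2.length = l.length := by
  induction l generalizing s with
  | nil => simp [splits] at hs; simp [hs]
  | cons i l ih =>
    simp only [splits, List.mem_append, List.mem_map] at hs
    rcases hs with ⟨t, ht, rfl⟩ | ⟨t, ht, rfl⟩ <;> have := ih ht <;> simp <;> omega

theorem prod_of_mem_splits (b : ι → ℝ) {l : List ι} {s : List ι × List ι} (hs : s ∈ splits l) :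
    (s.1.map b).prod * (s.2.map b).prod = (l.map b).prod := by
  induction l generalizing s with
  | nil => simp [splits] at hs; simp [hs]
  | cons i l ih =>
    simp only [splits, List.mem_append, List.mem_map] at hs
    rcases hs with ⟨t, ht, rfl⟩ | ⟨t, ht, rfl⟩ <;> have := ih ht <;> simp <;> rw [← this] <;> ring

/-- Exactly `n.choose i` splits have a first part of length `i`; the induction is Pascal's rule.
Bounds that see only the lengths thus become binomial sums. -/
theorem sum_splits_eq_choose (l : List ι) (h : ℕ → ℕ → ℝ) :
    ((splits l).map fun s => h s.1.length s.2.length).sum =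
      ∑ ij ∈ Finset.HasAntidiagonal.antidiagonal l.length, (l.length.choose ij.1 : ℝ) * h ij.1 ij.2 := by
  induction l generalizing h with
  | nil => simp [splits]
  | cons i l ih =>
    have h1 := ih fun m n => h (m + 1) n
    have h2 := ih fun m n => h m (n + 1)
    rw [List.length_cons, Finset.sum_antidiagonal_choose_succ_mul, splits, List.map_append,
      List.sum_append, List.map_map, List.map_map]
    simp only [Function.comp_def, List.length_cons]
    rw [h1, h2, add_comm]
    congr 1
    refine Finset.sum_congr rfl fun ij hij => ?_
    rw [Nat.choose_symm_of_eq_add (Finset.HasAntidiagonal.mem_antidiagonal.1 hij).symm]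

/-- Isolates the term in which every derivative falls on the second factor: the leading term of the
differentiated equation. In the others the second list is strictly shorter, as induction requires.
-/
theorem sum_splits_eq_add {M : Type*} [AddCommMonoid M] (l : List ι) (f : List ι × List ι → M) :
    ((splits l).map f).sum =
      f ([], l) + ((splits l).map fun s => if s.1.length = 0 then 0 else f s).sum := by
  induction l generalizing f with
  | nil => simp [splits]
  | cons i l ih =>
    simp only [splits, List.map_append, List.sum_append, List.map_map, Function.comp_def,
      List.length_cons]
    rw [ih fun s => f (s.1, i :: s.2)]
    simp only [Nat.add_one_ne_zero, if_false]
    abel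

theorem lineDeriv_list_sum {α : Type*} (L : List α) (g : α → V → X)
    (hg : ∀ a, ContDiff ℝ ∞ (g a)) (ξ v : V) :
    ContDiff ℝ ∞ (fun ξ => (L.map fun a => g a ξ).sum) ∧
    lineDeriv ℝ (fun ξ => (L.map fun a => g a ξ).sum) ξ v =
      (L.map fun a => lineDeriv ℝ (g a) ξ v).sum := by
  induction L with
  | nil => simp [lineDeriv, contDiff_const]
  | cons a L ih =>
    simp only [List.map_cons, List.sum_cons]
    refine ⟨(hg a).add ih.1, ?_⟩
    rw [← ih.2]
    have h1 := ((hg a).differentiable (by simp) ξ)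
    have h2 := (ih.1.differentiable (by simp) ξ)
    rw [h1.lineDeriv_eq_fderiv, h2.lineDeriv_eq_fderiv,
      (h1.fun_add h2).lineDeriv_eq_fderiv, fderiv_fun_add h1 h2]
    rfl

theorem lineDeriv_bilin (B : X →L[ℝ] Y →L[ℝ] Z) {F : V → X} {G : V → Y}
    (hF : ContDiff ℝ ∞ F) (hG : ContDiff ℝ ∞ G) (ξ v : V) :
    lineDeriv ℝ (fun ξ => B (F ξ) (G ξ)) ξ v =
      B (lineDeriv ℝ F ξ v) (G ξ) + B (F ξ) (lineDeriv ℝ G ξ v) := by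
  have h1 := hF.differentiable (by simp) ξ
  have h2 := hG.differentiable (by simp) ξ
  have h3 := B.hasFDerivAt_of_bilinear h1.hasFDerivAt h2.hasFDerivAt
  rw [h3.differentiableAt.lineDeriv_eq_fderiv, h3.fderiv, h1.lineDeriv_eq_fderiv,
    h2.lineDeriv_eq_fderiv]
  simp [add_comm]

/-- The Leibniz rule for iterated directional derivatives of a bilinear expression. -/
theorem dirDeriv_bilin (e : ι → V) (B : X →L[ℝ] Y →L[ℝ] Z) {F : V → X} {G : V → Y}
    (hF : ContDiff ℝ ∞ F) (hG : ContDiff ℝ ∞ G) (l : List ι) :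
    dirDeriv e l (fun ξ => B (F ξ) (G ξ)) = fun ξ =>
      ((splits l).map fun s => B (dirDeriv e s.1 F ξ) (dirDeriv e s.2 G ξ)).sum := by
  induction l with
  | nil => simp [splits]
  | cons i l ih =>
    rw [dirDeriv_cons, ih]
    funext ξ
    have hs : ∀ s : List ι × List ι, ContDiff ℝ ∞
        fun ξ => B (dirDeriv e s.1 F ξ) (dirDeriv e s.2 G ξ) := fun s =>
      (B.contDiff.comp (contDiff_dirDeriv e s.1 hF)).clm_apply (contDiff_dirDeriv e s.2 hG)
    rw [(lineDeriv_list_sum (splits l) _ hs ξ (e i)).2]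
    simp only [splits, List.map_append, List.sum_append, List.map_map, Function.comp_def]
    rw [← List.sum_map_add]
    congr 1
    refine List.map_congr_left fun s _ => ?_
    exact lineDeriv_bilin B (contDiff_dirDeriv e s.1 hF) (contDiff_dirDeriv e s.2 hG) ξ (e i)

end DirDeriv

/-! ### Factorial and binomial sums -/

section Combinatorics

open Finset.HasAntidiagonal (antidiagonal)

theorem choose_mul_factorial_le {n i j : ℕ} (h : i + j = n) :
    (n.choose i : ℝ) * (j.factorial : ℝ) ≤ n.factorial := by
  subst h
  have h1 := Nat.add_choose_mul_factorial_mul_factorial i j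
  rw [← Nat.choose_symm_add] at h1
  have h2 := Nat.factorial_pos i
  norm_cast
  rw [← h1, mul_right_comm]
  exact Nat.le_mul_of_pos_right _ h2

/-- Compares `(i + j)! / i!` with `(m + i + j)! / (m + i)!`: both have `j` consecutive factors, the
latter starting `m` higher. -/
theorem factorial_mul_factorial_le (m i j : ℕ) :
    (i + j).factorial * (m + i).factorial ≤ i.factorial * (m + (i + j)).factorial := by
  induction j with
  | zero => simp
  | succ j ih =>
    rw [← add_assoc i j 1, ← add_assoc m (i + j) 1, Nat.factorial_succ, Nat.factorial_succ]
    calc (i + j + 1) * (i + j).factorial * (m + i).factorial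
        = (i + j + 1) * ((i + j).factorial * (m + i).factorial) := by ring
      _ ≤ (m + (i + j) + 1) * (i.factorial * (m + (i + j)).factorial) :=
          Nat.mul_le_mul (by omega) ih
      _ = _ := by ring

theorem choose_mul_factorial_mul_factorial_le {m n i j : ℕ} (h : i + j = n) :
    (n.choose i : ℝ) * ((m + i).factorial * (j + 1).factorial) ≤
      (j + 1) * (m + n).factorial := by
  subst h
  have h1 := Nat.add_choose_mul_factorial_mul_factorial i j
  rw [← Nat.choose_symm_add] at h1
  have h2 := factorial_mul_factorial_le m i j
  have h3 := Nat.factorial_pos i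
  norm_cast
  refine Nat.le_of_mul_le_mul_left (c := i.factorial) ?_ h3
  calc i.factorial * ((i + j).choose i * ((m + i).factorial * (j + 1).factorial))
      = (j + 1) * (((i + j).choose i * i.factorial * j.factorial) * (m + i).factorial) := by
        rw [Nat.factorial_succ]; ring
    _ ≤ (j + 1) * (i.factorial * (m + (i + j)).factorial) := by
        rw [h1]; exact Nat.mul_le_mul_left _ h2
    _ = _ := by ring

theorem sum_antidiagonal_two_pow (n : ℕ) :
    ∑ ij ∈ antidiagonal n, (2 : ℝ) ^ ij.2 = 2 ^ (n + 1) - 1 := by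
  induction n with
  | zero => norm_num
  | succ n ih =>
    rw [Finset.Nat.sum_antidiagonal_succ, ih]
    ring

/-- This closes the energy recursion and fixes its base 2: `n.choose i * j! ≤ n!`, and the powers `2
^ j` with `j < n` sum to `2 ^ n - 1`. -/
theorem sum_choose_mul_factorial_two_pow_le (n : ℕ) :
    ∑ ij ∈ antidiagonal n, (n.choose ij.1 : ℝ) *
      (if ij.1 = 0 then 0 else (ij.2.factorial : ℝ) * 2 ^ ij.2) ≤ n.factorial * 2 ^ n := by
  have h1 : ∀ ij ∈ antidiagonal n, (n.choose ij.1 : ℝ) *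
      (if ij.1 = 0 then 0 else (ij.2.factorial : ℝ) * 2 ^ ij.2) ≤
      n.factorial * (if ij.1 = 0 then 0 else 2 ^ ij.2) := by
    intro ij hij
    have := choose_mul_factorial_le (Finset.HasAntidiagonal.mem_antidiagonal.1 hij)
    split_ifs
    · simp
    · rw [← mul_assoc]
      gcongr
  refine (Finset.sum_le_sum h1).trans ?_
  rw [← Finset.mul_sum]
  gcongr
  cases n with
  | zero => simp
  | succ n =>
    rw [Finset.Nat.sum_antidiagonal_succ]
    simp only [if_true, Nat.add_one_ne_zero, if_false, zero_add]
    rw [sum_antidiagonal_two_pow]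
    linarith

/-- A geometric sum of ratio at most 1/2. The subtracted `4 ^ n` makes the induction close, which
needs exactly `8 ≤ B`. -/
theorem sum_antidiagonal_pow_mul_four_pow_le {B : ℝ} (hB : 8 ≤ B) (n : ℕ) :
    ∑ ij ∈ antidiagonal n, B ^ ij.1 * 4 ^ ij.2 ≤ 2 * B ^ n - 4 ^ n := by
  induction n with
  | zero => norm_num
  | succ n ih =>
    rw [Finset.Nat.sum_antidiagonal_succ]
    have : ∑ ij ∈ antidiagonal n, B ^ (ij.1 + 1) * 4 ^ ij.2 =
        B * ∑ ij ∈ antidiagonal n, B ^ ij.1 * 4 ^ ij.2 := by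
      rw [Finset.mul_sum]
      exact Finset.sum_congr rfl fun _ _ => by ring
    rw [this]
    have h4 : (0 : ℝ) < 4 ^ n := by positivity
    have h1 := mul_le_mul_of_nonneg_left ih (by linarith : (0 : ℝ) ≤ B)
    have h2 := mul_le_mul_of_nonneg_right hB h4.le
    simp only [pow_succ, pow_zero]
    nlinarith

theorem sum_choose_mul_factorial_mul_pow_le {B : ℝ} (hB : 8 ≤ B) (m n : ℕ) :
    ∑ ij ∈ antidiagonal n, (n.choose ij.1 : ℝ) *
      (((m + ij.1).factorial * B ^ ij.1) * ((ij.2 + 1).factorial * 2 ^ (ij.2 + 1))) ≤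
      4 * ((m + n).factorial * B ^ n) := by
  have hB0 : 0 ≤ B := by linarith
  have h1 : ∀ ij ∈ antidiagonal n, (n.choose ij.1 : ℝ) *
      (((m + ij.1).factorial * B ^ ij.1) * ((ij.2 + 1).factorial * 2 ^ (ij.2 + 1))) ≤
      (m + n).factorial * 2 * (B ^ ij.1 * 4 ^ ij.2) := by
    intro ij hij
    have h2 := choose_mul_factorial_mul_factorial_le (m := m) (Finset.HasAntidiagonal.mem_antidiagonal.1 hij)
    -- The spare factor `j + 1` costs another `2 ^ j`; this is why base 4 appears.
    have h3 : ((ij.2 : ℝ) + 1) ≤ 2 ^ ij.2 := by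
      exact_mod_cast Nat.lt_two_pow_self (n := ij.2)
    have h4 : (4 : ℝ) ^ ij.2 = 2 ^ ij.2 * 2 ^ ij.2 := by
      rw [← mul_pow]; norm_num
    calc _ = ((n.choose ij.1 : ℝ) * ((m + ij.1).factorial * (ij.2 + 1).factorial)) *
          (B ^ ij.1 * 2 ^ (ij.2 + 1)) := by ring
      _ ≤ (2 ^ ij.2 * (m + n).factorial) * (B ^ ij.1 * 2 ^ (ij.2 + 1)) := by
          exact mul_le_mul_of_nonneg_right (h2.trans (by gcongr)) (by positivity)
      _ = _ := by rw [h4]; ring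
  refine (Finset.sum_le_sum h1).trans ?_
  rw [← Finset.mul_sum]
  have h5 := sum_antidiagonal_pow_mul_four_pow_le hB n
  have h6 : (0 : ℝ) < 4 ^ n := by positivity
  calc _ ≤ ((m + n).factorial : ℝ) * 2 * (2 * B ^ n) := by gcongr; linarith
    _ = _ := by ring

end Combinatorics

/-! ### Derivative bounds for the variational solution and for compositions -/

section Estimates

variable {ι V W : Type*} [NormedAddCommGroup V] [NormedSpace ℝ V]
  [NormedAddCommGroup W] [NormedSpace ℝ W]

theorem prod_map_nonneg {b : ι → ℝ} (hb : ∀ i, 0 ≤ b i) (l : List ι) : 0 ≤ (l.map b).prod :=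
  List.prod_nonneg (by simpa using fun i _ => hb i)

theorem abs_list_sum_le {α : Type*} (L : List α) (g : α → ℝ) {h : α → ℝ}
    (hgh : ∀ a ∈ L, |g a| ≤ h a) : |(L.map g).sum| ≤ (L.map h).sum := by
  induction L with
  | nil => simp
  | cons a L ih =>
    simp only [List.map_cons, List.sum_cons]
    exact (abs_add_le _ _).trans (add_le_add (hgh a (by simp)) (ih fun a ha => hgh a (by simp [ha])))

/-- Energy bound for the derivatives of the solution `p` of a parametrized variational problem. -/
theorem energy_dirDeriv_le (e : ι → V) {a : V → W →L[ℝ] W →L[ℝ] ℝ} {p : V → W} {f : W →L[ℝ] ℝ}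
    (ha : ContDiff ℝ ∞ a) (hp : ContDiff ℝ ∞ p) (hf : ∀ ξ, a ξ (p ξ) = f)
    {b : ι → ℝ} (hb : ∀ i, 0 ≤ b i) {N : W → ℝ} (hN : ∀ v, 0 ≤ N v) {ξ : V}
    (haN : ∀ v, N v ^ 2 = a ξ v v)
    (hab : ∀ l ≠ [], ∀ v w, |dirDeriv e l a ξ v w| ≤ (l.map b).prod * (N v * N w))
    (l : List ι) :
    N (dirDeriv e l p ξ) ≤ (l.map b).prod * (l.length.factorial * 2 ^ l.length) * N (p ξ) := by
  induction hn : l.length using Nat.strong_induction_on generalizing l with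
  | _ n ih =>
  subst hn
  rcases eq_or_ne l [] with rfl | hl
  · simp
  -- The identity, read as a bilinear map, is the evaluation `(a, p) ↦ a p`; its value here is the
  -- constant `f`, so the Leibniz sum vanishes.
  have h0 := dirDeriv_bilin e (ContinuousLinearMap.id ℝ (W →L[ℝ] W →L[ℝ] ℝ)) ha hp l
  simp only [ContinuousLinearMap.id_apply, hf] at h0
  rw [dirDeriv_const e l hl] at h0
  set q := dirDeriv e l p ξ with hq
  have h1 := congrArg (fun G : W →L[ℝ] ℝ => G q) (congrFun h0 ξ)
  have h2 : ∀ L : List (W →L[ℝ] ℝ), L.sum q = (L.map fun G => G q).sum := by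
    intro L
    induction L with
    | nil => simp
    | cons G L ih => simp [ih]
  simp only [Pi.zero_apply, zero_apply, h2, List.map_map,
    Function.comp_def] at h1
  rw [sum_splits_eq_add] at h1
  simp only [dirDeriv_nil, ← hq, ← haN] at h1
  -- The tested equation bounds `N q ^ 2` by a multiple of `N q`; dividing requires `N q ≠ 0`.
  rcases (hN q).eq_or_lt with h3 | h3
  · rw [← h3]
    have := prod_map_nonneg hb l
    have := hN (p ξ)
    positivity
  have h4 : ∀ s ∈ splits l, |(if s.1.length = 0 then 0 else
      dirDeriv e s.1 a ξ (dirDeriv e s.2 p ξ) q)| ≤ (l.map b).prod * N (p ξ) * N q *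
        (if s.1.length = 0 then 0 else (s.2.length.factorial : ℝ) * 2 ^ s.2.length) := by
    intro s hs
    split_ifs with h
    · simp
    · have h5 := hab s.1 (by simpa using h) (dirDeriv e s.2 p ξ) q
      have h6 := length_of_mem_splits hs
      have h7 := ih s.2.length (by omega) s.2 rfl
      have h8 := prod_map_nonneg hb s.1
      calc _ ≤ (s.1.map b).prod * (((s.2.map b).prod * (s.2.length.factorial * 2 ^ s.2.length) *
            N (p ξ)) * N q) := h5.trans (by gcongr)
        _ = ((s.1.map b).prod * (s.2.map b).prod) * N (p ξ) * N q *
            (s.2.length.factorial * 2 ^ s.2.length) := by ring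
        _ = _ := by rw [prod_of_mem_splits b hs]
  have h5 := abs_list_sum_le (splits l) _ h4
  rw [List.sum_map_mul_left] at h5
  rw [sum_splits_eq_choose l fun i j => if i = 0 then 0 else (j.factorial : ℝ) * 2 ^ j] at h5
  have h6 := sum_choose_mul_factorial_two_pow_le l.length
  have h7 := prod_map_nonneg hb l
  have h8 := hN (p ξ)
  have h9 : N q ^ 2 ≤ (l.map b).prod * N (p ξ) * N q * (l.length.factorial * 2 ^ l.length) := by
    refine le_trans ?_ (mul_le_mul_of_nonneg_left h6 (by positivity))
    refine le_trans ?_ h5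
    rw [← abs_neg]
    refine le_trans ?_ (le_abs_self _)
    linarith
  refine le_of_mul_le_mul_right ?_ h3
  calc N q * N q = N q ^ 2 := by ring
    _ ≤ _ := h9
    _ = _ := by ring

theorem contDiff_of_hasDerivAt_succ {th : ℕ → ℝ → ℝ}
    (hth : ∀ m t, HasDerivAt (th m) (th (m + 1) t) t) (m : ℕ) : ContDiff ℝ ∞ (th m) := by
  rw [contDiff_infty]
  intro n
  induction n generalizing m with
  | zero =>
    exact contDiff_zero.2 (continuous_iff_continuousAt.2 fun t => (hth m t).continuousAt)
  | succ n ih =>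
    rw [Nat.cast_succ, contDiff_succ_iff_deriv]
    refine ⟨fun t => (hth m t).differentiableAt, by simp, ?_⟩
    rw [show deriv (th m) = th (m + 1) from funext fun t => (hth m t).deriv]
    exact ih (m + 1)

/-- Bound for the derivatives of the composition of a function whose `m`-th derivatives are of
order `m!` with a function that satisfies factorial bounds. -/
theorem abs_dirDeriv_comp_le (e : ι → V) {th : ℕ → ℝ → ℝ} {z : V → ℝ}
    (hth : ∀ m t, HasDerivAt (th m) (th (m + 1) t) t) (hz : ContDiff ℝ ∞ z)
    {C : ℝ} (hC : 0 ≤ C) (hthC : ∀ m t, |th m t| ≤ C * m.factorial)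
    {b : ι → ℝ} (hb : ∀ i, 0 ≤ b i) {κ' κ : ℝ} (hκ' : 0 ≤ κ') (hκ : κ' ≤ κ) {ξ : V}
    (hzb : ∀ l ≠ [], |dirDeriv e l z ξ| ≤
      κ' * ((l.map b).prod * (l.length.factorial * 2 ^ l.length)))
    (l : List ι) (m : ℕ) :
    |dirDeriv e l (fun ξ => th m (z ξ)) ξ| ≤
      C * ((l.map b).prod * ((m + l.length).factorial * (8 * (1 + κ)) ^ l.length)) ∧
    (l ≠ [] → |dirDeriv e l (fun ξ => th m (z ξ)) ξ| ≤
      C * κ' * ((l.map b).prod * ((m + l.length).factorial * (8 * (1 + κ)) ^ l.length))) := by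
  induction hn : l.length using Nat.strong_induction_on generalizing l m with
  | _ n ih =>
  subst hn
  -- The last entry is differentiated first, so the chain rule applies there; the remaining list
  -- then acts on a product.
  rcases List.eq_nil_or_concat l with rfl | ⟨l, j, rfl⟩
  · simpa using hthC m (z ξ)
  simp only [List.concat_eq_append] at *
  set B : ℝ := 8 * (1 + κ) with hBdef
  have hB : 8 ≤ B := by rw [hBdef]; linarith
  have hB0 : 0 ≤ B := by linarith
  have hd : dirDeriv e [j] (fun ξ => th m (z ξ)) =
      fun ξ => ContinuousLinearMap.mul ℝ ℝ (th (m + 1) (z ξ)) (dirDeriv e [j] z ξ) := by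
    funext ξ
    have hz' := hz.differentiable (by simp) ξ
    have h1 := (hth m (z ξ)).comp_hasFDerivAt ξ hz'.hasFDerivAt
    simp only [dirDeriv_cons, dirDeriv_nil]
    rw [show (fun ξ => th m (z ξ)) = th m ∘ z from rfl,
      h1.differentiableAt.lineDeriv_eq_fderiv, hz'.lineDeriv_eq_fderiv, h1.fderiv]
    simp
  have hs1 : ContDiff ℝ ∞ fun ξ => th (m + 1) (z ξ) :=
    (contDiff_of_hasDerivAt_succ hth (m + 1)).comp hz
  have hs2 := contDiff_dirDeriv e [j] hz
  have hP := prod_map_nonneg hb (l ++ [j])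
  -- Only the first of the two bounds enters the recursion, at level `m + 1`; the single factor `κ'`
  -- comes from the derivative of `z`.
  have key : |dirDeriv e (l ++ [j]) (fun ξ => th m (z ξ)) ξ| ≤
      C * κ' * ((l ++ [j]).map b).prod * (4 * ((m + 1 + l.length).factorial * B ^ l.length)) := by
    rw [dirDeriv_append, hd, dirDeriv_bilin e _ hs1 hs2]
    have h4 : ∀ s ∈ splits l, |ContinuousLinearMap.mul ℝ ℝ
        (dirDeriv e s.1 (fun ξ => th (m + 1) (z ξ)) ξ) (dirDeriv e s.2 (dirDeriv e [j] z) ξ)| ≤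
        C * κ' * ((l ++ [j]).map b).prod * (((m + 1 + s.1.length).factorial * B ^ s.1.length) *
          ((s.2.length + 1).factorial * 2 ^ (s.2.length + 1))) := by
      intro s hs
      have hlen := length_of_mem_splits hs
      have h5 := (ih s.1.length (by simp; omega) s.1 (m + 1) rfl).1
      have h6 := hzb (s.2 ++ [j]) (by simp)
      rw [dirDeriv_append] at h6
      have h7 := prod_map_nonneg hb s.1
      rw [ContinuousLinearMap.mul_apply', abs_mul]
      refine (mul_le_mul h5 h6 (abs_nonneg _) (by positivity)).trans_eq ?_
      rw [List.map_append (l₁ := l), List.prod_append, ← prod_of_mem_splits b hs]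
      simp only [List.map_append, List.prod_append, List.length_append, List.length_singleton]
      ring
    refine (abs_list_sum_le (splits l) _ h4).trans ?_
    rw [List.sum_map_mul_left, sum_splits_eq_choose l fun i k =>
      ((m + 1 + i).factorial * B ^ i) * ((k + 1).factorial * 2 ^ (k + 1) : ℝ)]
    exact mul_le_mul_of_nonneg_left (sum_choose_mul_factorial_mul_pow_le hB (m + 1) l.length)
      (by positivity)
  have e1 : m + (l ++ [j]).length = m + 1 + l.length := by simp; omega
  have e2 : (l ++ [j]).length = l.length + 1 := by simp
  rw [e1, e2, pow_succ]
  constructor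
  · refine key.trans ?_
    -- The new factor of the base `B` absorbs `4 κ'`; for the second bound it absorbs only 4, and
    -- `κ'` stays in front.
    calc _ = C * (((l ++ [j]).map b).prod * ((m + 1 + l.length).factorial *
          (B ^ l.length * (4 * κ')))) := by ring
      _ ≤ _ := by
        gcongr
        rw [hBdef]; linarith
  · intro _
    refine key.trans ?_
    calc _ = C * κ' * (((l ++ [j]).map b).prod * ((m + 1 + l.length).factorial *
          (B ^ l.length * 4))) := by ring
      _ ≤ _ := by
        gcongr
        linarith

end Estimates

/-! ### Cauchy estimates for the Gaussian -/

section Gaussian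

/-- The entire extension of `t ↦ exp (-|y - t|² / (2 σ²))`. -/
def cgauss (y σ : ℝ) (w : ℂ) : ℂ := Complex.exp (-((1 / (2 * σ ^ 2) : ℝ) * (y - w) ^ 2))

/-- The `m`-th derivative of `t ↦ exp (-|y - t|² / (2 σ²))`. -/
def gaussDeriv (y σ : ℝ) (m : ℕ) (t : ℝ) : ℝ := (iteratedDeriv m (cgauss y σ) t).re

theorem contDiff_cgauss (y σ : ℝ) : ContDiff ℂ ω (cgauss y σ) := by
  unfold cgauss
  fun_prop

theorem hasDerivAt_gaussDeriv (y σ : ℝ) (m : ℕ) (t : ℝ) :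
    HasDerivAt (gaussDeriv y σ m) (gaussDeriv y σ (m + 1) t) t := by
  have h := ((contDiff_cgauss y σ).differentiable_iteratedDeriv m (by simp)) (t : ℂ)
  have h1 := h.hasDerivAt.real_of_complex
  rwa [← iteratedDeriv_succ] at h1

/-- Cauchy's estimate on the unit circle about `t`: there `|Im w| ≤ 1`, so the exponent has real
part at most `1 / (2σ²)`, uniformly in `t` and `y`. -/
theorem abs_gaussDeriv_le (y : ℝ) (σ : ℝ) (m : ℕ) (t : ℝ) :
    |gaussDeriv y σ m t| ≤ Real.exp (1 / (2 * σ ^ 2)) * m.factorial := by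
  refine (Complex.abs_re_le_norm _).trans ?_
  have h := Complex.norm_iteratedDeriv_le_of_forall_mem_sphere_norm_le (f := cgauss y σ)
    (c := (t : ℂ)) (R := 1) (C := Real.exp (1 / (2 * σ ^ 2))) m one_pos
    ((contDiff_cgauss y σ).differentiable (by simp)).diffContOnCl ?_
  · rw [one_pow, div_one, mul_comm] at h
    exact h
  · intro w hw
    have h1 : |w.im| ≤ 1 := by
      have h2 : ‖w - t‖ = 1 := by simpa [dist_eq_norm] using hw
      have h3 := Complex.abs_im_le_norm (w - t)
      rw [h2] at h3
      simpa using h3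
    rw [cgauss, Complex.norm_exp, Real.exp_le_exp]
    have h4 : (-(((1 / (2 * σ ^ 2) : ℝ) : ℂ) * (y - w) ^ 2)).re =
        -((1 / (2 * σ ^ 2)) * ((y - w.re) ^ 2 - w.im ^ 2)) := by
      rw [Complex.neg_re, Complex.re_ofReal_mul, sq (_ - w : ℂ), Complex.mul_re]
      simp only [Complex.sub_re, Complex.sub_im, Complex.ofReal_re, Complex.ofReal_im]
      ring
    rw [h4]
    have h5 : (0 : ℝ) ≤ 1 / (2 * σ ^ 2) := by positivity
    have h6 : w.im ^ 2 ≤ 1 := by rw [← sq_abs]; exact pow_le_one₀ (abs_nonneg _) h1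
    nlinarith [sq_nonneg (y - w.re)]

theorem theta_eq_gaussDeriv {V : Type*} (H : V → ℝ) (y σ : ℝ) (v : V) :
    theta H y σ v = gaussDeriv y σ 0 (H v) := by
  rw [theta, gaussDeriv, iteratedDeriv_zero, cgauss, sq_abs]
  rw [← Complex.ofReal_sub, ← Complex.ofReal_pow, ← Complex.ofReal_mul, ← Complex.ofReal_neg,
    Complex.exp_ofReal_re]

end Gaussian

/-! ### Coercive forms: Cauchy–Schwarz, Lax–Milgram, smooth dependence -/

section Hilbert

variable {V W : Type*} [NormedAddCommGroup V] [NormedSpace ℝ V]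
  [NormedAddCommGroup W] [InnerProductSpace ℝ W]

/-- A bilinear form dominated by a positive definite quadratic form satisfies the
Cauchy-Schwarz inequality for the energy norm. -/
theorem abs_bilin_le_of_le_add {A B : W →L[ℝ] W →L[ℝ] ℝ} (hA : ∀ v ≠ 0, 0 < A v v) {β : ℝ}
    (h : ∀ v w, |B v w| ≤ β / 2 * (A v v + A w w)) (v w : W) :
    |B v w| ≤ β * (√(A v v) * √(A w w)) := by
  rcases eq_or_ne v 0 with rfl | hv
  · simp
  rcases eq_or_ne w 0 with rfl | hw
  · simp
  have h1 := Real.sqrt_pos.2 (hA v hv)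
  have h2 := Real.sqrt_pos.2 (hA w hw)
  -- The rescaled vectors have equal energy, so the arithmetic mean in `h` becomes the geometric
  -- one.
  have h3 := h (√(A w w) • v) (√(A v v) • w)
  simp only [map_smul, smul_apply, smul_eq_mul, abs_mul, abs_of_pos h1,
    abs_of_pos h2] at h3
  have h4 := Real.sq_sqrt (hA v hv).le
  have h5 := Real.sq_sqrt (hA w hw).le
  set s := √(A v v)
  set t := √(A w w)
  refine le_of_mul_le_mul_left ?_ (mul_pos h1 h2)
  calc s * t * |B v w| = s * (t * |B v w|) := by ring
    _ ≤ _ := h3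
    _ = s * t * (β * (s * t)) := by rw [← h4, ← h5]; ring

variable [CompleteSpace W]

/-- Lax-Milgram: a coercive form is an isomorphism onto the dual space. -/
theorem exists_equiv_of_isCoercive {B : W →L[ℝ] W →L[ℝ] ℝ} (hB : IsCoercive B) :
    ∃ e : W ≃L[ℝ] (W →L[ℝ] ℝ), (e : W →L[ℝ] W →L[ℝ] ℝ) = B := by
  have hker : B.ker = ⊥ := by
    rw [LinearMap.ker_eq_bot']
    intro v hv
    have h : hB.continuousLinearEquivOfBilin v = 0 := by
      refine ext_inner_right ℝ fun w => ?_
      rw [hB.continuousLinearEquivOfBilin_apply, inner_zero_left]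
      exact congrArg (fun G : W →L[ℝ] ℝ => G w) hv
    simpa using h
  have hrange : B.range = ⊤ := by
    rw [LinearMap.range_eq_top]
    intro f
    refine ⟨hB.continuousLinearEquivOfBilin.symm ((InnerProductSpace.toDual ℝ W).symm f), ?_⟩
    ext w
    have h := hB.continuousLinearEquivOfBilin_apply
      (hB.continuousLinearEquivOfBilin.symm ((InnerProductSpace.toDual ℝ W).symm f)) w
    rw [ContinuousLinearEquiv.apply_symm_apply, InnerProductSpace.toDual_symm_apply] at h
    exact h.symm
  exact ⟨ContinuousLinearEquiv.ofBijective B hker hrange,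
    ContinuousLinearEquiv.coe_ofBijective B hker hrange⟩

/-- The solution of a coercive variational problem depends smoothly on the parameters. -/
theorem contDiff_of_isCoercive {a : V → W →L[ℝ] W →L[ℝ] ℝ} {p : V → W} {f : W →L[ℝ] ℝ}
    (ha : ContDiff ℝ ∞ a) (hc : ∀ ξ, IsCoercive (a ξ)) (hf : ∀ ξ, a ξ (p ξ) = f) :
    ContDiff ℝ ∞ p := by
  -- Smoothness follows because operator inversion is smooth at isomorphisms.
  have hp : p = fun ξ => (a ξ).inverse f := by
    funext ξ
    obtain ⟨e, he⟩ := exists_equiv_of_isCoercive (hc ξ)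
    rw [← hf ξ, ← he, ContinuousLinearMap.inverse_equiv]
    exact (e.symm_apply_apply (p ξ)).symm
  rw [hp, contDiff_iff_contDiffAt]
  intro ξ
  obtain ⟨e, he⟩ := exists_equiv_of_isCoercive (hc ξ)
  have h1 : ContDiffAt ℝ ∞ ContinuousLinearMap.inverse (a ξ) := by
    rw [← he]
    exact contDiffAt_map_inverse e
  exact (h1.comp ξ ha.contDiffAt).clm_apply contDiffAt_const

end Hilbert

/-! ### The weighted form on `L²(D; ℝᵈ)`, bounded and linear in the coefficient -/

section L2Form

variable {d : ℕ} {D : Set (E d)}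

/-- Extension of a continuous function on `closure D` by zero. -/
def extendZero (k : C(closure D, ℝ)) : E d → ℝ := Function.extend Subtype.val k 0

theorem extendZero_apply (k : C(closure D, ℝ)) {x : E d} (hx : x ∈ closure D) :
    extendZero k x = k ⟨x, hx⟩ :=
  Subtype.val_injective.extend_apply k 0 ⟨x, hx⟩

theorem aestronglyMeasurable_extendZero (k : C(closure D, ℝ)) :
    AEStronglyMeasurable (extendZero k) (volume.restrict D) := by
  have h : ContinuousOn (extendZero k) (closure D) := by
    rw [continuousOn_iff_continuous_domRestrict]
    convert k.continuous using 1
    funext x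
    exact extendZero_apply k x.2
  exact (h.aestronglyMeasurable isClosed_closure.measurableSet).mono_measure
    (Measure.restrict_mono subset_closure le_rfl)

theorem ae_mem_closure (D : Set (E d)) : ∀ᵐ x ∂(volume.restrict D), x ∈ closure D := by
  have h : ∀ᵐ x ∂(volume.restrict (closure D)), x ∈ closure D :=
    ae_restrict_mem isClosed_closure.measurableSet
  exact (Measure.restrict_mono subset_closure le_rfl).absolutelyContinuous.ae_le h

/-- The form `(v, w) ↦ ∫_D k v · w` on `L²(D; ℝᵈ)`. -/
def intForm (k : C(closure D, ℝ)) (v w : Lp (E d) 2 (volume.restrict D)) : ℝ :=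
  ∫ x in D, extendZero k x * inner ℝ (v x) (w x)

theorem intForm_comm (k : C(closure D, ℝ)) (v w : Lp (E d) 2 (volume.restrict D)) :
    intForm k v w = intForm k w v := by
  simp only [intForm, real_inner_comm]

theorem intForm_smul_left (k : C(closure D, ℝ)) (c : ℝ) (v w : Lp (E d) 2 (volume.restrict D)) :
    intForm k (c • v) w = c * intForm k v w := by
  unfold intForm
  rw [← integral_const_mul]
  refine integral_congr_ae ?_
  filter_upwards [Lp.coeFn_smul c v] with x hx
  rw [hx, Pi.smul_apply, real_inner_smul_left]
  ring

theorem intForm_smul (c : ℝ) (k : C(closure D, ℝ)) (v w : Lp (E d) 2 (volume.restrict D)) :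
    intForm (c • k) v w = c * intForm k v w := by
  unfold intForm
  rw [← integral_const_mul]
  refine integral_congr_ae ?_
  filter_upwards [ae_mem_closure D] with x hx
  simp only [extendZero_apply _ hx, ContinuousMap.smul_apply, smul_eq_mul, mul_assoc]

variable [CompactSpace (closure D)]

theorem ae_norm_extendZero_le (k : C(closure D, ℝ)) :
    ∀ᵐ x ∂(volume.restrict D), ‖extendZero k x‖ ≤ ‖k‖ := by
  filter_upwards [ae_mem_closure D] with x hx
  rw [extendZero_apply k hx]
  exact k.norm_coe_le_norm _

theorem integrable_extendZero_mul_inner (k : C(closure D, ℝ))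
    (v w : Lp (E d) 2 (volume.restrict D)) :
    Integrable (fun x => extendZero k x * inner ℝ (v x) (w x)) (volume.restrict D) :=
  (L2.integrable_inner v w).bdd_mul (aestronglyMeasurable_extendZero k) (ae_norm_extendZero_le k)

theorem abs_intForm_le_norm (k : C(closure D, ℝ)) (v w : Lp (E d) 2 (volume.restrict D)) :
    |intForm k v w| ≤ ‖k‖ * ‖v‖ * ‖w‖ := by
  have hle : ∀ᵐ x ∂(volume.restrict D), ‖extendZero k x • v x‖ ≤ ‖k‖ * ‖v x‖ := by
    filter_upwards [ae_norm_extendZero_le k] with x hx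
    rw [norm_smul]
    gcongr
  have hm : MemLp (fun x => extendZero k x • v x) 2 (volume.restrict D) :=
    (Lp.memLp v).of_le_mul
      ((aestronglyMeasurable_extendZero k).smul (Lp.aestronglyMeasurable v)) hle
  have h1 : intForm k v w = inner ℝ (hm.toLp _) w := by
    rw [intForm, L2.inner_def]
    refine integral_congr_ae ?_
    filter_upwards [hm.coeFn_toLp] with x hx
    rw [hx, real_inner_smul_left]
  have h2 : ‖hm.toLp _‖ ≤ ‖k‖ * ‖v‖ := by
    refine Lp.norm_le_mul_norm_of_ae_le_mul ?_
    filter_upwards [hm.coeFn_toLp, hle] with x hx hx'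
    rwa [hx]
  rw [h1]
  exact (abs_real_inner_le_norm _ _).trans (by gcongr)

theorem intForm_add_left (k : C(closure D, ℝ)) (v v' w : Lp (E d) 2 (volume.restrict D)) :
    intForm k (v + v') w = intForm k v w + intForm k v' w := by
  unfold intForm
  rw [← integral_add (integrable_extendZero_mul_inner k _ _)
    (integrable_extendZero_mul_inner k _ _)]
  refine integral_congr_ae ?_
  filter_upwards [Lp.coeFn_add v v'] with x hx
  rw [hx, Pi.add_apply, inner_add_left, mul_add]

theorem intForm_add (k k' : C(closure D, ℝ)) (v w : Lp (E d) 2 (volume.restrict D)) :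
    intForm (k + k') v w = intForm k v w + intForm k' v w := by
  unfold intForm
  rw [← integral_add (integrable_extendZero_mul_inner k _ _)
    (integrable_extendZero_mul_inner k' _ _)]
  refine integral_congr_ae ?_
  filter_upwards [ae_mem_closure D] with x hx
  simp only [extendZero_apply _ hx, ContinuousMap.add_apply, add_mul]

theorem intForm_self_ge {k : C(closure D, ℝ)} {c : ℝ} (hk : ∀ x, c ≤ k x)
    (v : Lp (E d) 2 (volume.restrict D)) : c * ‖v‖ ^ 2 ≤ intForm k v v := by
  have h : c * ‖v‖ ^ 2 = ∫ x in D, c * inner ℝ (v x) (v x) := by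
    rw [integral_const_mul, ← L2.inner_def, real_inner_self_eq_norm_sq]
  rw [h, intForm]
  refine integral_mono_ae ((L2.integrable_inner v v).const_mul c)
    (integrable_extendZero_mul_inner k _ _) ?_
  filter_upwards [ae_mem_closure D] with x hx
  simp only [extendZero_apply _ hx]
  exact mul_le_mul_of_nonneg_right (hk _) real_inner_self_nonneg

/-- Pointwise Young inequality under the integral; `abs_bilin_le_of_le_add` upgrades the sum to a
product of energy norms. -/
theorem abs_intForm_le {k g : C(closure D, ℝ)} {β : ℝ} (hg : ∀ x, |g x| ≤ β * k x)
    (v w : Lp (E d) 2 (volume.restrict D)) :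
    |intForm g v w| ≤ β / 2 * (intForm k v v + intForm k w w) := by
  unfold intForm
  rw [← integral_add (integrable_extendZero_mul_inner k _ _)
    (integrable_extendZero_mul_inner k _ _), ← integral_const_mul, ← Real.norm_eq_abs]
  have hint := ((integrable_extendZero_mul_inner k v v).add
    (integrable_extendZero_mul_inner k w w)).const_mul (β / 2)
  refine norm_integral_le_of_norm_le hint ?_
  filter_upwards [ae_mem_closure D] with x hx
  simp only [extendZero_apply _ hx, real_inner_self_eq_norm_sq, norm_mul, Real.norm_eq_abs]
  have h1 := hg ⟨x, hx⟩
  have h2 := abs_real_inner_le_norm (v x) (w x)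
  have h3 : (0 : ℝ) ≤ β * k ⟨x, hx⟩ := (abs_nonneg _).trans h1
  calc |g ⟨x, hx⟩| * |inner ℝ (v x) (w x)| ≤ (β * k ⟨x, hx⟩) * (‖v x‖ * ‖w x‖) := by gcongr
    _ ≤ (β * k ⟨x, hx⟩) * ((‖v x‖ ^ 2 + ‖w x‖ ^ 2) / 2) := by
      gcongr
      linarith [two_mul_le_add_sq ‖v x‖ ‖w x‖]
    _ = _ := by ring

variable {W : Type*} [NormedAddCommGroup W] [InnerProductSpace ℝ W]

/-- The form `(v, w) ↦ ∫_D k v · w` on a space embedded in `L²(D; ℝᵈ)`. -/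
def l2Lin (i : W →ₗᵢ[ℝ] Lp (E d) 2 (volume.restrict D)) (k : C(closure D, ℝ)) :
    W →ₗ[ℝ] W →ₗ[ℝ] ℝ :=
  LinearMap.mk₂ ℝ (fun v w : W => intForm k (i v) (i w))
    (fun v v' w => by rw [i.map_add, intForm_add_left])
    (fun c v w => by rw [i.map_smul, intForm_smul_left, smul_eq_mul])
    (fun v w w' => by
      rw [i.map_add, intForm_comm, intForm_add_left, intForm_comm, intForm_comm k (i w')])
    (fun c v w => by
      rw [i.map_smul, intForm_comm, intForm_smul_left, intForm_comm, smul_eq_mul])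

theorem norm_l2Lin_le (i : W →ₗᵢ[ℝ] Lp (E d) 2 (volume.restrict D)) (k : C(closure D, ℝ))
    (v w : W) : ‖l2Lin i k v w‖ ≤ ‖k‖ * ‖v‖ * ‖w‖ := by
  have h := abs_intForm_le_norm k (i v) (i w)
  rw [i.norm_map, i.norm_map] at h
  exact h

/-- The form `(v, w) ↦ ∫_D k v · w` as a bounded bilinear form. -/
def l2Bilin (i : W →ₗᵢ[ℝ] Lp (E d) 2 (volume.restrict D)) (k : C(closure D, ℝ)) :
    W →L[ℝ] W →L[ℝ] ℝ :=
  LinearMap.mkContinuous₂ (l2Lin i k) ‖k‖ (norm_l2Lin_le i k)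

theorem l2Bilin_apply (i : W →ₗᵢ[ℝ] Lp (E d) 2 (volume.restrict D)) (k : C(closure D, ℝ))
    (v w : W) : l2Bilin i k v w = intForm k (i v) (i w) := rfl

/-- The form `(v, w) ↦ ∫_D k v · w` as a function of the coefficient `k`. -/
def l2Form (i : W →ₗᵢ[ℝ] Lp (E d) 2 (volume.restrict D)) :
    C(closure D, ℝ) →L[ℝ] W →L[ℝ] W →L[ℝ] ℝ :=
  LinearMap.mkContinuous
    { toFun := l2Bilin i
      map_add' := fun k k' => by
        ext v w
        simp only [add_apply, l2Bilin_apply, intForm_add]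
      map_smul' := fun c k => by
        ext v w
        simp only [smul_apply, l2Bilin_apply, RingHom.id_apply, smul_eq_mul, intForm_smul] }
    1 (fun k => by
      rw [one_mul]
      exact LinearMap.mkContinuous₂_norm_le (l2Lin i k) (norm_nonneg k) (norm_l2Lin_le i k))

theorem l2Form_apply (i : W →ₗᵢ[ℝ] Lp (E d) 2 (volume.restrict D)) (k : C(closure D, ℝ))
    (v w : W) : l2Form i k v w = intForm k (i v) (i w) := rfl

theorem l2Form_self_ge (i : W →ₗᵢ[ℝ] Lp (E d) 2 (volume.restrict D)) {k : C(closure D, ℝ)} {c : ℝ}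
    (hk : ∀ x, c ≤ k x) (v : W) : c * ‖v‖ ^ 2 ≤ l2Form i k v v := by
  rw [← i.norm_map]
  exact intForm_self_ge hk (i v)

theorem isCoercive_l2Form (i : W →ₗᵢ[ℝ] Lp (E d) 2 (volume.restrict D)) {k : C(closure D, ℝ)}
    {c : ℝ} (hc : 0 < c) (hk : ∀ x, c ≤ k x) : IsCoercive (l2Form i k) :=
  ⟨c, hc, fun v => by
    have := l2Form_self_ge i hk v
    rwa [mul_assoc, ← sq]⟩

end L2Form

/-! ### The coefficient as a smooth map into the Banach algebra `C(X, ℝ)` -/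

section Coefficient

variable {X : Type*} [TopologicalSpace X] [CompactSpace X] {J : ℕ}

/-- The expansion `m + ∑ j, ξ j ψ j` in `C⁰`. -/
def expansion (m : C(X, ℝ)) (ψ : Fin J → C(X, ℝ)) (ξ : Fin J → ℝ) : C(X, ℝ) :=
  m + ∑ j, ξ j • ψ j

theorem hasFDerivAt_expansion (m : C(X, ℝ)) (ψ : Fin J → C(X, ℝ)) (ξ : Fin J → ℝ) :
    HasFDerivAt (expansion m ψ)
      (∑ j, (ContinuousLinearMap.proj (R := ℝ) (φ := fun _ : Fin J => ℝ) j).smulRight (ψ j)) ξ := by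
  have h := (∑ j, (ContinuousLinearMap.proj (R := ℝ)
    (φ := fun _ : Fin J => ℝ) j).smulRight (ψ j)).hasFDerivAt (x := ξ)
  have h' : expansion m ψ = fun ξ => m + (∑ j, (ContinuousLinearMap.proj (R := ℝ)
      (φ := fun _ : Fin J => ℝ) j).smulRight (ψ j)) ξ := by
    funext ξ
    simp [expansion]
  rw [h']
  exact h.const_add m

theorem contDiff_expansion (m : C(X, ℝ)) (ψ : Fin J → C(X, ℝ)) :
    ContDiff ℝ ∞ (expansion m ψ) := by
  unfold expansion
  fun_prop

theorem contDiff_exp_expansion (m : C(X, ℝ)) (ψ : Fin J → C(X, ℝ)) :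
    ContDiff ℝ ∞ fun ξ => NormedSpace.exp (expansion m ψ ξ) := by
  have h : ContDiff ℝ ∞ (NormedSpace.exp : C(X, ℝ) → C(X, ℝ)) :=
    contDiff_iff_contDiffAt.2 fun x => (NormedSpace.exp_analytic (𝕂 := ℝ) x).contDiffAt
  exact h.comp (contDiff_expansion m ψ)

theorem exp_apply (u : C(X, ℝ)) (x : X) : NormedSpace.exp u x = Real.exp (u x) := by
  have h := NormedSpace.map_exp (ContinuousMap.evalAlgHom ℝ ℝ x)
    (ContinuousEvalConst.continuous_eval_const x) u
  simpa [Real.exp_eq_exp_ℝ] using h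

/-- The first derivative removes `ks`; each derivative multiplies the exponential by one `ψ i`. -/
theorem dirDeriv_coeff (ks m : C(X, ℝ)) (ψ : Fin J → C(X, ℝ)) (l : List (Fin J)) (hl : l ≠ []) :
    dirDeriv (fun j => Pi.single j (1 : ℝ)) l
      (fun ξ => ks + NormedSpace.exp (expansion m ψ ξ)) =
      fun ξ => (l.map ψ).prod * NormedSpace.exp (expansion m ψ ξ) := by
  have h : ∀ (c : C(X, ℝ)) (ξ : Fin J → ℝ), HasFDerivAt
      (fun ξ => c * NormedSpace.exp (expansion m ψ ξ)) (c •
        ((NormedSpace.exp (expansion m ψ ξ) • (1 : C(X, ℝ) →L[ℝ] C(X, ℝ))).comp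
          (∑ j, (ContinuousLinearMap.proj (R := ℝ)
            (φ := fun _ : Fin J => ℝ) j).smulRight (ψ j)))) ξ := fun c ξ =>
    ((_root_.hasFDerivAt_exp (𝕂 := ℝ)).comp ξ (hasFDerivAt_expansion m ψ ξ)).const_mul c
  have hs : ∀ i, (∑ j, (ContinuousLinearMap.proj (R := ℝ)
      (φ := fun _ : Fin J => ℝ) j).smulRight (ψ j)) (Pi.single i 1) = ψ i := by
    intro i
    simp [Pi.single_apply]
  induction l with
  | nil => exact absurd rfl hl
  | cons i l ih =>
    rw [dirDeriv_cons]
    funext ξ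
    rcases eq_or_ne l [] with rfl | h'
    · have h1 := (h 1 ξ).const_add ks
      simp only [one_mul] at h1
      rw [dirDeriv_nil, (h1.hasLineDerivAt _).lineDeriv, smul_apply,
        ContinuousLinearMap.comp_apply, hs]
      simp [mul_comm]
    · rw [ih h', ((h _ ξ).hasLineDerivAt _).lineDeriv, smul_apply,
        ContinuousLinearMap.comp_apply, hs]
      simp
      ring

end Coefficient

/-! ### Bounds for functionals of the solution and for the likelihood -/

section Likelihood

variable {d : ℕ} {D : Set (E d)} [CompactSpace (closure D)] {W : Type*} [NormedAddCommGroup W]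
  [InnerProductSpace ℝ W] {J : ℕ}

/-- The coefficient `k* + exp (m + ∑ j, ξ j ψ j)` in `C⁰(closure D)`. -/
def coeff (ks m : C(closure D, ℝ)) (ψ : Fin J → C(closure D, ℝ)) (ξ : Fin J → ℝ) :
    C(closure D, ℝ) :=
  ks + NormedSpace.exp (expansion m ψ ξ)

theorem contDiff_coeff (ks m : C(closure D, ℝ)) (ψ : Fin J → C(closure D, ℝ)) :
    ContDiff ℝ ∞ (coeff ks m ψ) :=
  contDiff_const.add (contDiff_exp_expansion m ψ)

theorem contDiff_l2Form_coeff (i : W →ₗᵢ[ℝ] Lp (E d) 2 (volume.restrict D))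
    (ks m : C(closure D, ℝ)) (ψ : Fin J → C(closure D, ℝ)) :
    ContDiff ℝ ∞ fun ξ => l2Form i (coeff ks m ψ ξ) :=
  ContDiff.continuousLinearMap_comp (F := C(closure D, ℝ)) (G := W →L[ℝ] W →L[ℝ] ℝ) (l2Form i)
    (contDiff_coeff ks m ψ)

theorem coeff_apply (ks m : C(closure D, ℝ)) (ψ : Fin J → C(closure D, ℝ)) (ξ : Fin J → ℝ)
    (x : closure D) : coeff ks m ψ ξ x = ks x + Real.exp (expansion m ψ ξ x) := by
  rw [coeff, ContinuousMap.add_apply, exp_apply]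

theorem abs_prod_map_le {X : Type*} [TopologicalSpace X] {ψ : Fin J → C(X, ℝ)}
    {b : Fin J → ℝ} {x : X} (hψ : ∀ j, |ψ j x| ≤ b j) (l : List (Fin J)) :
    |(l.map ψ).prod x| ≤ (l.map b).prod := by
  induction l with
  | nil => simp
  | cons j l ih =>
    simp only [List.map_cons, List.prod_cons, ContinuousMap.mul_apply, abs_mul]
    exact mul_le_mul (hψ j) ih (abs_nonneg _) ((abs_nonneg _).trans (hψ j))

/-- Two conversions between energy norm and norm, each costing `1/√c`, give `1/c`. Only a lower
bound of the coefficient at this `ξ` enters, so `c` may be the local minimum. -/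
theorem abs_dirDeriv_functional_le (i : W →ₗᵢ[ℝ] Lp (E d) 2 (volume.restrict D)) {f h : W →L[ℝ] ℝ}
    {nf nh : ℝ} (hf : ‖f‖ ≤ nf) (hh : ‖h‖ ≤ nh) {ks m : C(closure D, ℝ)}
    {ψ : Fin J → C(closure D, ℝ)} (hks : ∀ x, 0 ≤ ks x) {b : Fin J → ℝ}
    (hψ : ∀ j x, |ψ j x| ≤ b j) (hb : ∀ j, 0 ≤ b j)
    {p : (Fin J → ℝ) → W} (hps : ContDiff ℝ ∞ p) (hp : ∀ ξ, l2Form i (coeff ks m ψ ξ) (p ξ) = f)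
    (ξ : Fin J → ℝ) {c : ℝ} (hc : 0 < c) (hcξ : ∀ x, c ≤ coeff ks m ψ ξ x) (l : List (Fin J)) :
    |dirDeriv (fun j => Pi.single j (1 : ℝ)) l (fun ξ => h (p ξ)) ξ| ≤
      nh * nf / c * ((l.map b).prod * (l.length.factorial * 2 ^ l.length)) := by
  have hnf : 0 ≤ nf := (norm_nonneg f).trans hf
  have hnh : 0 ≤ nh := (norm_nonneg h).trans hh
  set A := l2Form i (coeff ks m ψ ξ) with hA
  have has : ContDiff ℝ ∞ fun ξ => l2Form i (coeff ks m ψ ξ) :=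
    contDiff_l2Form_coeff i ks m ψ
  have hAge : ∀ v, c * ‖v‖ ^ 2 ≤ A v v := l2Form_self_ge i hcξ
  have hA0 : ∀ v, 0 ≤ A v v := fun v => (by positivity : 0 ≤ c * ‖v‖ ^ 2).trans (hAge v)
  have hApos : ∀ v ≠ 0, 0 < A v v := fun v hv =>
    (mul_pos hc (pow_pos (norm_pos_iff.2 hv) 2)).trans_le (hAge v)
  have hN : ∀ v, √c * ‖v‖ ≤ √(A v v) := fun v => by
    rw [← Real.sqrt_sq (norm_nonneg v), ← Real.sqrt_mul hc.le]
    exact Real.sqrt_le_sqrt (hAge v)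
  have hab : ∀ l ≠ [], ∀ v w,
      |dirDeriv (fun j => Pi.single j (1 : ℝ)) l (fun ξ => l2Form i (coeff ks m ψ ξ)) ξ v w| ≤
        (l.map b).prod * (√(A v v) * √(A w w)) := by
    intro l hl v w
    rw [dirDeriv_clm_comp (X := C(closure D, ℝ)) (Y := W →L[ℝ] W →L[ℝ] ℝ) _ l (l2Form i)
      (contDiff_coeff ks m ψ)]
    unfold coeff
    rw [dirDeriv_coeff ks m ψ l hl]
    refine abs_bilin_le_of_le_add hApos (fun v w => ?_) v w
    refine abs_intForm_le (fun x => ?_) (i v) (i w)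
    rw [coeff_apply, ContinuousMap.mul_apply, exp_apply, abs_mul, abs_of_pos (Real.exp_pos _)]
    have h1 := abs_prod_map_le (fun j => hψ j x) l
    have h2 := (abs_nonneg _).trans h1
    gcongr
    linarith [hks x]
  have hE := energy_dirDeriv_le (fun j => Pi.single j (1 : ℝ)) has hps hp hb
    (fun v => Real.sqrt_nonneg (A v v)) (fun v => Real.sq_sqrt (hA0 v)) hab l
  rw [dirDeriv_clm_comp _ l h hps]
  set q := dirDeriv (fun j => Pi.single j (1 : ℝ)) l p ξ
  have hsc : 0 < √c := Real.sqrt_pos.2 hc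
  -- Testing the equation with the solution itself: `N(p)² = f(p)`.
  have hpN : √c * √(A (p ξ) (p ξ)) ≤ nf := by
    rcases (Real.sqrt_nonneg (A (p ξ) (p ξ))).eq_or_lt with h0 | h0
    · rw [← h0, mul_zero]; exact hnf
    refine le_of_mul_le_mul_right ?_ h0
    calc √c * √(A (p ξ) (p ξ)) * √(A (p ξ) (p ξ)) = √c * A (p ξ) (p ξ) := by
          rw [mul_assoc, Real.mul_self_sqrt (hA0 _)]
      _ = √c * f (p ξ) := by rw [hA, hp ξ]
      _ ≤ √c * (nf * ‖p ξ‖) := by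
          gcongr
          exact (le_abs_self _).trans ((f.le_opNorm _).trans (by gcongr))
      _ = nf * (√c * ‖p ξ‖) := by ring
      _ ≤ nf * √(A (p ξ) (p ξ)) := by gcongr; exact hN _
  have hP := prod_map_nonneg hb l
  have h1 : |h q| ≤ nh * ‖q‖ := (h.le_opNorm q).trans (by gcongr)
  refine h1.trans ?_
  rw [div_mul_eq_mul_div, le_div_iff₀ hc]
  calc nh * ‖q‖ * c = nh * (√c * (√c * ‖q‖)) := by
        rw [← mul_assoc √c, Real.mul_self_sqrt hc.le]; ring
    _ ≤ nh * (√c * ((l.map b).prod * (l.length.factorial * 2 ^ l.length) *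
        √(A (p ξ) (p ξ)))) := by
        have h2 := (hN q).trans hE
        gcongr nh * (√c * ?_)
    _ = nh * ((l.map b).prod * (l.length.factorial * 2 ^ l.length)) *
        (√c * √(A (p ξ) (p ξ))) := by ring
    _ ≤ nh * ((l.map b).prod * (l.length.factorial * 2 ^ l.length)) * nf := by gcongr
    _ = _ := by ring

/-- Smoothness of and derivative bounds for the likelihood, on a Hilbert space embedded in
`L²(D; ℝᵈ)`. -/
theorem abs_dirDeriv_likelihood_le [CompleteSpace W]
    (i : W →ₗᵢ[ℝ] Lp (E d) 2 (volume.restrict D)) {f h : W →L[ℝ] ℝ} {nf nh : ℝ} (hf : ‖f‖ ≤ nf) (hh : ‖h‖ ≤ nh) {ks m : C(closure D, ℝ)}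
    {ψ : Fin J → C(closure D, ℝ)} {c₀ : ℝ} (hc₀ : 0 < c₀) (hks : ∀ x, c₀ ≤ ks x) {b : Fin J → ℝ}
    (hψ : ∀ j x, |ψ j x| ≤ b j) (hb : ∀ j, 0 ≤ b j)
    {p : (Fin J → ℝ) → W} (hp : ∀ ξ, l2Form i (coeff ks m ψ ξ) (p ξ) = f) (y σ : ℝ)
    {κ : ℝ} (hκ : nh * nf / c₀ ≤ κ) :
    ContDiff ℝ ∞ (fun ξ => gaussDeriv y σ 0 (h (p ξ))) ∧
    ∀ (ξ : Fin J → ℝ) (c : ℝ), c₀ ≤ c → (∀ x, c ≤ coeff ks m ψ ξ x) → ∀ l ≠ [],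
      |dirDeriv (fun j => Pi.single j (1 : ℝ)) l (fun ξ => gaussDeriv y σ 0 (h (p ξ))) ξ| ≤
        Real.exp (1 / (2 * σ ^ 2)) * (nh * nf / c) *
          ((l.map b).prod * (l.length.factorial * (8 * (1 + κ)) ^ l.length)) := by
  have hnf : 0 ≤ nf := (norm_nonneg f).trans hf
  have hnh : 0 ≤ nh := (norm_nonneg h).trans hh
  have has : ContDiff ℝ ∞ fun ξ => l2Form i (coeff ks m ψ ξ) :=
    contDiff_l2Form_coeff i ks m ψ
  have hcoer : ∀ ξ, IsCoercive (l2Form i (coeff ks m ψ ξ)) := fun ξ =>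
    isCoercive_l2Form i hc₀ fun x => by
      rw [coeff_apply]
      linarith [hks x, Real.exp_pos (expansion m ψ ξ x)]
  have hps : ContDiff ℝ ∞ p := contDiff_of_isCoercive has hcoer hp
  have hz : ContDiff ℝ ∞ fun ξ => h (p ξ) := h.contDiff.comp hps
  refine ⟨(contDiff_of_hasDerivAt_succ (hasDerivAt_gaussDeriv y σ) 0).comp hz, ?_⟩
  intro ξ c hc hcξ l hl
  have hc' : 0 < c := hc₀.trans_le hc
  -- The local bound `c` enters the prefactor, the global `c₀` the base of the power.
  have hκ' : nh * nf / c ≤ κ := le_trans (by gcongr) hκ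
  have h := (abs_dirDeriv_comp_le (fun j => Pi.single j (1 : ℝ)) (hasDerivAt_gaussDeriv y σ) hz
    (Real.exp_pos _).le (abs_gaussDeriv_le y σ) hb (by positivity) hκ' (ξ := ξ)
    (fun l _ => abs_dirDeriv_functional_le i hf hh (fun x => hc₀.le.trans (hks x)) hψ hb hps hp ξ
      hc' hcξ l) l 0).2 hl
  rwa [zero_add] at h

end Likelihood

/-! ### Multi-indices in `{0,1}^J` as lists -/

section MixedPartial

variable {J : ℕ}

/-- The list consists of the `j` with `ν j = 1` in the order of the fold, so symmetry of mixed
derivatives is not needed. -/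
theorem exists_list_mixedPartial (ν : Fin J → ℕ) (hν : ∀ j, ν j ≤ 1) :
    ∃ l : List (Fin J), (∀ F : (Fin J → ℝ) → ℝ,
        mixedPartial ν F = dirDeriv (fun j => Pi.single j (1 : ℝ)) l F) ∧
      l.length = ∑ j, ν j ∧ ∀ b : Fin J → ℝ, (l.map b).prod = ∏ j, b j ^ ν j := by
  have key : ∀ L : List (Fin J), ∃ l : List (Fin J), (∀ F : (Fin J → ℝ) → ℝ,
      L.foldr (fun j G => (partialDeriv j)^[ν j] G) F =
        dirDeriv (fun j => Pi.single j (1 : ℝ)) l F) ∧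
      l.length = (L.map ν).sum ∧
      ∀ b : Fin J → ℝ, (l.map b).prod = (L.map fun j => b j ^ ν j).prod := by
    intro L
    induction L with
    | nil => exact ⟨[], fun F => rfl, rfl, fun b => rfl⟩
    | cons j L ih =>
      obtain ⟨l, h1, h2, h3⟩ := ih
      rcases Nat.le_one_iff_eq_zero_or_eq_one.1 (hν j) with h | h
      · exact ⟨l, fun F => by simp [h, h1], by simp [h, h2], fun b => by simp [h, h3]⟩
      · refine ⟨j :: l, fun F => ?_, by simp [h, h2, add_comm], fun b => by simp [h, h3]⟩
        simp only [List.foldr_cons, h, Function.iterate_one, h1]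
        rfl
  obtain ⟨l, h1, h2, h3⟩ := key (List.finRange J)
  refine ⟨l, h1, ?_, fun b => ?_⟩
  · rw [h2, Fin.sum_univ_def]
  · rw [h3, Fin.prod_univ_def]

end MixedPartial

/-! ### Passage from a subspace of `H¹₀(D)` to a Hilbert space of gradients -/

section Embedding

variable {d : ℕ} {D : Set (E d)}

theorem H10.norm_eq (v : H10 D) : ‖v‖ = ‖H10.grad v‖ := rfl

/-- The completion of a subspace of `H¹₀(D)` in the norm `‖∇v‖`, embedded in `L²(D; ℝᵈ)`. -/
theorem exists_hilbert_completion (S : Submodule ℝ (H10 D)) :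
    ∃ (W : Type) (_ : NormedAddCommGroup W) (_ : InnerProductSpace ℝ W) (_ : CompleteSpace W)
      (i : W →ₗᵢ[ℝ] Lp (E d) 2 (volume.restrict D)) (e : S →ₗ[ℝ] W), DenseRange e ∧
      ∀ v : S, i (e v) = H10.grad (v : H10 D) := by
  let T := S.map (H10.grad (D := D))
  have hmem : ∀ v : S, H10.grad (v : H10 D) ∈ T.topologicalClosure := fun v =>
    T.le_topologicalClosure (Submodule.mem_map_of_mem v.2)
  have : CompleteSpace T.topologicalClosure :=
    T.isClosed_topologicalClosure.completeSpace_coe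
  refine ⟨T.topologicalClosure, inferInstance, inferInstance, this,
    T.topologicalClosure.subtypeₗᵢ,
    LinearMap.codRestrict T.topologicalClosure ((H10.grad (D := D)).comp S.subtype) hmem, ?_,
    fun v => rfl⟩
  rintro ⟨w, hw⟩
  rw [closure_subtype]
  refine closure_mono ?_ hw
  rintro _ ⟨v, hv, rfl⟩
  exact ⟨⟨H10.grad v, hmem ⟨v, hv⟩⟩, ⟨⟨v, hv⟩, rfl⟩, rfl⟩

/-- The norm of `H¹₀(D)` is that of the gradient, so `f` is bounded by `‖f‖ ‖e v‖` on `S` and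
extends by density without increase of norm. -/
theorem exists_extension {S : Submodule ℝ (H10 D)} {W : Type*} [NormedAddCommGroup W]
    [InnerProductSpace ℝ W] {i : W →ₗᵢ[ℝ] Lp (E d) 2 (volume.restrict D)} {e : S →ₗ[ℝ] W}
    (he : DenseRange e) (hie : ∀ v : S, i (e v) = H10.grad (v : H10 D))
    (f : StrongDual ℝ (H10 D)) :
    ∃ g : W →L[ℝ] ℝ, ‖g‖ ≤ ‖f‖ ∧ ∀ v : S, g (e v) = f v := by
  have hle : ∀ v : S, ‖((f : H10 D →ₗ[ℝ] ℝ).comp S.subtype) v‖ ≤ ‖f‖ * ‖e v‖ := fun v => by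
    rw [← i.norm_map, hie, ← H10.norm_eq]
    exact f.le_opNorm v
  exact ⟨LinearMap.extendOfNorm ((f : H10 D →ₗ[ℝ] ℝ).comp S.subtype) e,
    LinearMap.opNorm_extendOfNorm_le he (norm_nonneg f) hle,
    fun v => LinearMap.extendOfNorm_eq he ⟨_, hle⟩ v⟩

end Embedding

/-! ### Return to the original data -/

section Main

variable {d : ℕ} {D : Set (E d)}

theorem kMin_le (hD : IsCompact (closure D)) {k : E d → ℝ} (hk : ContinuousOn k (closure D))
    {x : E d} (hx : x ∈ closure D) : kMin D k ≤ k x :=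
  csInf_le (hD.image_of_continuousOn hk).bddBelow (mem_image_of_mem k hx)

theorem kMin_pos (hD : IsCompact (closure D)) (hne : D.Nonempty) {k : E d → ℝ}
    (hk : ContinuousOn k (closure D)) (hpos : ∀ x ∈ closure D, 0 < k x) : 0 < kMin D k := by
  obtain ⟨x, hx, h⟩ := (hD.image_of_continuousOn hk).sInf_mem (hne.closure.image k)
  rw [kMin, ← h]
  exact hpos x hx

theorem kMin_mono (hD : IsCompact (closure D)) (hne : D.Nonempty) {k k' : E d → ℝ}
    (hk : ContinuousOn k (closure D)) (h : ∀ x ∈ closure D, k x ≤ k' x) :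
    kMin D k ≤ kMin D k' := by
  refine le_csInf (hne.closure.image k') ?_
  rintro _ ⟨x, hx, rfl⟩
  exact (kMin_le hD hk hx).trans (h x hx)

theorem abs_le_supNorm (hD : IsCompact (closure D)) {g : E d → ℝ}
    (hg : ContinuousOn g (closure D)) {x : E d} (hx : x ∈ closure D) : |g x| ≤ supNorm D g :=
  le_csSup (hD.image_of_continuousOn hg.abs).bddAbove (mem_image_of_mem (fun x => |g x|) hx)

theorem supNorm_nonneg (D : Set (E d)) (g : E d → ℝ) : 0 ≤ supNorm D g := by
  refine Real.sSup_nonneg ?_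
  rintro _ ⟨x, -, rfl⟩
  exact abs_nonneg _

/-- The restriction to `closure D` of a function which is continuous there. -/
def toC {g : E d → ℝ} (hg : ContinuousOn g (closure D)) : C(closure D, ℝ) :=
  ⟨(closure D).domRestrict g, hg.domRestrict⟩

theorem continuousOn_kJ {kstar m0 : E d → ℝ} {γ : ℕ → ℝ} {φ : ℕ → E d → ℝ}
    (hk : ContinuousOn kstar (closure D)) (hm : ContinuousOn m0 (closure D))
    (hφ : ∀ j, ContinuousOn (φ j) (closure D)) {J : ℕ} (ξ : Fin J → ℝ) :
    ContinuousOn (kJ kstar m0 γ φ ξ) (closure D) := by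
  refine hk.add (Real.continuous_exp.comp_continuousOn (hm.add ?_))
  exact continuousOn_finsetSum _ fun j _ => continuousOn_const.mul (hφ j)

theorem coeff_toC [CompactSpace (closure D)] {kstar m0 : E d → ℝ} {γ : ℕ → ℝ} {φ : ℕ → E d → ℝ}
    (hk : ContinuousOn kstar (closure D)) (hm : ContinuousOn m0 (closure D))
    (hφ : ∀ j, ContinuousOn (φ j) (closure D)) {J : ℕ} (ξ : Fin J → ℝ) (x : closure D) :
    coeff (toC hk) (toC hm) (fun j : Fin J => γ j • toC (hφ j)) ξ x = kJ kstar m0 γ φ ξ x := by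
  rw [coeff_apply, kJ, uJ, expansion, ContinuousMap.add_apply, ContinuousMap.sum_apply]
  congr 3
  refine Finset.sum_congr rfl fun j _ => ?_
  simp only [ContinuousMap.smul_apply, smul_eq_mul]
  rw [mul_comm (γ j) (ξ j), mul_assoc]
  rfl

theorem intForm_eq_bform {k : C(closure D, ℝ)} {k' : E d → ℝ} (h : ∀ x : closure D, k x = k' x)
    (v w : H10 D) : intForm k (H10.grad v) (H10.grad w) = bform k' v w := by
  refine integral_congr_ae ?_
  filter_upwards [ae_mem_closure D] with x hx
  rw [extendZero_apply k hx, h]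

/-- Smoothness of and derivative bounds for the likelihood of the Galerkin solution in a subspace
`S` of `H¹₀(D)`. -/
theorem abs_dirDeriv_theta_le (hD : IsCompact (closure D)) (hne : D.Nonempty)
    {kstar m0 : E d → ℝ} {γ : ℕ → ℝ} {φ : ℕ → E d → ℝ}
    (hk : ContinuousOn kstar (closure D)) (hkpos : ∀ x ∈ closure D, 0 < kstar x)
    (hm : ContinuousOn m0 (closure D)) (hγ : ∀ j, 0 ≤ γ j)
    (hφ : ∀ j, ContinuousOn (φ j) (closure D)) (f H : StrongDual ℝ (H10 D)) (y σ : ℝ)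
    (S : Submodule ℝ (H10 D)) {J : ℕ} {p : (Fin J → ℝ) → H10 D} (hpS : ∀ ξ, p ξ ∈ S)
    (hp : ∀ ξ, ∀ q ∈ S, bform (kJ kstar m0 γ φ ξ) (p ξ) q = f q) :
    ContDiff ℝ ∞ (fun ξ => theta H y σ (p ξ)) ∧
    ∀ (ξ : Fin J → ℝ), ∀ l ≠ [],
      |dirDeriv (fun j => Pi.single j (1 : ℝ)) l (fun ξ => theta H y σ (p ξ)) ξ| ≤
        Real.exp (1 / (2 * σ ^ 2)) * (‖H‖ * ‖f‖ / kMin D (kJ kstar m0 γ φ ξ)) *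
          ((l.map fun j : Fin J => γ j * supNorm D (φ j)).prod *
            (l.length.factorial * (8 * (1 + ‖H‖ * ‖f‖ / kMin D kstar)) ^ l.length)) := by
  have : CompactSpace (closure D) := isCompact_iff_compactSpace.1 hD
  obtain ⟨W, _, _, _, i, e, he, hie⟩ := exists_hilbert_completion S
  obtain ⟨f', hf', hf'e⟩ := exists_extension he hie f
  obtain ⟨H', hH', hH'e⟩ := exists_extension he hie H
  have hsol : ∀ ξ, l2Form i (coeff (toC hk) (toC hm) (fun j : Fin J => γ j • toC (hφ j)) ξ)
      (e ⟨p ξ, hpS ξ⟩) = f' := by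
    intro ξ
    -- Both functionals are continuous on `W` and agree on the dense image of `S`.
    refine DFunLike.coe_injective (he.equalizer (ContinuousLinearMap.continuous _)
      (ContinuousLinearMap.continuous _) ?_)
    funext q
    rw [Function.comp_apply, Function.comp_apply, l2Form_apply, hie, hie,
      intForm_eq_bform (coeff_toC hk hm hφ ξ), hf'e]
    exact hp ξ q q.2
  have hkm := kMin_pos hD hne hk hkpos
  have hθ : (fun ξ => theta H y σ (p ξ)) =
      fun ξ => gaussDeriv y σ 0 (H' (e ⟨p ξ, hpS ξ⟩)) := by
    funext ξ
    rw [theta_eq_gaussDeriv, hH'e]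
  have hψ : ∀ (j : Fin J) (x : closure D),
      |(γ j • toC (hφ j)) x| ≤ γ j * supNorm D (φ j) := by
    intro j x
    rw [ContinuousMap.smul_apply, smul_eq_mul, abs_mul, abs_of_nonneg (hγ j)]
    exact mul_le_mul_of_nonneg_left (abs_le_supNorm hD (hφ j) x.2) (hγ j)
  have hmain := abs_dirDeriv_likelihood_le i hf' hH' hkm (ks := toC hk)
    (fun x => kMin_le hD hk x.2) hψ (fun j => mul_nonneg (hγ j) (supNorm_nonneg D (φ j)))
    hsol y σ le_rfl
  rw [hθ]
  refine ⟨hmain.1, fun ξ l hl => hmain.2 ξ _ (kMin_mono hD hne hk fun x _ => ?_) (fun x => ?_) l hl⟩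
  · exact le_add_of_nonneg_right (Real.exp_pos _).le
  · rw [coeff_toC]
    exact kMin_le hD (continuousOn_kJ hk hm hφ ξ) x.2

end Main

end

end BayesFE

/-! ### Choice of the constants -/

theorem mainTheorem9 :
    ∀ κ₀ : ℝ, 0 < κ₀ → ∃ c_p : ℝ, 1 < c_p ∧
      ∀ (d : ℕ) (D : Set (E d)), IsOpen D → Bornology.IsBounded D → D.Nonempty →
      ∀ (kstar m0 : E d → ℝ) (γ : ℕ → ℝ) (φ : ℕ → E d → ℝ),
        ContinuousOn kstar (closure D) → (∀ x ∈ closure D, 0 < kstar x) →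
        ContinuousOn m0 (closure D) →
        (∀ j, 0 ≤ γ j) → (∀ j, ContinuousOn (φ j) (closure D)) →
      ∀ (f H : StrongDual ℝ (H10 D)) (y σ : ℝ), 0 < σ →
      ∀ κ c₁ : ℝ, κ = ‖H‖ * ‖f‖ / kMin D kstar → κ₀ ≤ κ →
        c₁ = c_p * max κ (κ ^ 2) / Real.log 2 →
        0 < c₁ ∧ ∃ C : ℝ, 0 < C ∧
          ∀ K : Geometry.SimplicialComplex ℝ (E d), IsTriangulation D K →
          ∀ (J : ℕ) (p : (Fin J → ℝ) → H10 D),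
            (∀ ξ, IsFESolution K (kJ kstar m0 γ φ ξ) f (p ξ)) →
            ContDiff ℝ ∞ (fun ξ => theta H y σ (p ξ)) ∧
            ∀ (ν : Fin J → ℕ), (∀ j, ν j ≤ 1) → ∀ ξ : Fin J → ℝ,
              |mixedPartial ν (fun ξ' => theta H y σ (p ξ')) ξ| ≤
                C * (c₁ ^ (∑ j, ν j) * (Nat.factorial (∑ j, ν j) : ℝ) / kMin D kstar) *
                  ∏ j : Fin J, (γ j * supNorm D (φ j)) ^ ν j ∧
              (ν ≠ 0 →
                |mixedPartial ν (fun ξ' => theta H y σ (p ξ')) ξ| ≤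
                  C * (c₁ ^ (∑ j, ν j) * (Nat.factorial (∑ j, ν j) : ℝ) /
                      kMin D (kJ kstar m0 γ φ ξ)) *
                    ∏ j : Fin J, (γ j * supNorm D (φ j)) ^ ν j) := by
  intro κ₀ hκ₀
  -- As `1 ≤ κ / κ₀`, the base `8 (1 + κ)` is at most `8 (1 / κ₀ + 1) κ`; the added 2 is slack, and
  -- dividing by `log 2 ≤ 1` only helps.
  refine ⟨8 * (1 / κ₀ + 1) + 2, by have := one_div_pos.2 hκ₀; linarith, ?_⟩
  intro d D _ hDb hne kstar m0 γ φ hk hkpos hm hγ hφ f H y σ _ κ c₁ hκ hκ₀κ hc₁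
  have hD : IsCompact (closure D) := hDb.isCompact_closure
  have hkm := kMin_pos hD hne hk hkpos
  have hκpos : 0 < κ := hκ₀.trans_le hκ₀κ
  have hlog : 0 < Real.log 2 := Real.log_pos (by norm_num)
  have hinv : 0 < 1 / κ₀ := one_div_pos.2 hκ₀
  have hmax : κ ≤ max κ (κ ^ 2) := le_max_left _ _
  have hc₁B : 8 * (1 + κ) ≤ c₁ := by
    have h1 : 1 ≤ 1 / κ₀ * κ := by
      rw [div_mul_eq_mul_div, one_mul, le_div_iff₀ hκ₀, one_mul]
      exact hκ₀κ
    have h2 : Real.log 2 ≤ 1 := by linarith [Real.log_two_lt_d9]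
    rw [hc₁, le_div_iff₀ hlog]
    calc 8 * (1 + κ) * Real.log 2 ≤ 8 * (1 + κ) * 1 := by gcongr
      _ ≤ (8 * (1 / κ₀ + 1) + 2) * κ := by nlinarith
      _ ≤ _ := by gcongr
  have hB : 0 ≤ 8 * (1 + κ) := by linarith
  -- The first summand serves `ν ≠ 0`. The second serves `ν = 0`, where `θ ≤ 1` and the right side
  -- is `C / kMin D kstar`; it also keeps `C` positive.
  refine ⟨by linarith, Real.exp (1 / (2 * σ ^ 2)) * (‖H‖ * ‖f‖) + kMin D kstar, by positivity, ?_⟩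
  intro K _ J p hp
  obtain ⟨hsmooth, hbound⟩ := abs_dirDeriv_theta_le hD hne hk hkpos hm hγ hφ f H y σ
    (feSpace D K) (fun ξ => (hp ξ).1) (fun ξ => (hp ξ).2)
  refine ⟨hsmooth, fun ν hν ξ => ?_⟩
  obtain ⟨l, hl1, hl2, hl3⟩ := exists_list_mixedPartial ν hν
  have hP : 0 ≤ ∏ j : Fin J, (γ j * supNorm D (φ j)) ^ ν j :=
    Finset.prod_nonneg fun j _ => pow_nonneg (mul_nonneg (hγ j) (supNorm_nonneg D (φ j))) _
  have hkξ : kMin D kstar ≤ kMin D (kJ kstar m0 γ φ ξ) :=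
    kMin_mono hD hne hk fun x _ => le_add_of_nonneg_right (Real.exp_pos _).le
  have hkξ0 := hkm.trans_le hkξ
  have hsecond : ν ≠ 0 → |mixedPartial ν (fun ξ' => theta H y σ (p ξ')) ξ| ≤
      (Real.exp (1 / (2 * σ ^ 2)) * (‖H‖ * ‖f‖) + kMin D kstar) *
        (c₁ ^ (∑ j, ν j) * (Nat.factorial (∑ j, ν j) : ℝ) / kMin D (kJ kstar m0 γ φ ξ)) *
          ∏ j : Fin J, (γ j * supNorm D (φ j)) ^ ν j := by
    intro hν0
    have hl : l ≠ [] := by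
      rintro rfl
      refine hν0 (funext fun j => ?_)
      simpa using (Finset.sum_eq_zero_iff.1 hl2.symm) j (Finset.mem_univ j)
    have h := hbound ξ l hl
    rw [hl3, hl2, ← hκ] at h
    rw [hl1]
    refine h.trans ?_
    calc _ = Real.exp (1 / (2 * σ ^ 2)) * (‖H‖ * ‖f‖) *
          ((8 * (1 + κ)) ^ (∑ j, ν j) * (Nat.factorial (∑ j, ν j) : ℝ) /
            kMin D (kJ kstar m0 γ φ ξ)) * ∏ j : Fin J, (γ j * supNorm D (φ j)) ^ ν j := by ring
      _ ≤ _ := by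
        gcongr
        linarith
  refine ⟨?_, hsecond⟩
  by_cases hν0 : ν = 0
  · have hl : l = [] := by
      rw [← List.length_eq_zero_iff, hl2, hν0]
      simp
    rw [hl1, hl, dirDeriv_nil, hν0]
    have h1 : |theta H y σ (p ξ)| ≤ 1 := by
      rw [theta, abs_of_pos (Real.exp_pos _), Real.exp_le_one_iff, neg_nonpos]
      positivity
    simp only [Pi.zero_apply, Finset.sum_const_zero, pow_zero, Nat.factorial_zero, Nat.cast_one,
      mul_one, Finset.prod_const_one]
    refine h1.trans ?_
    rw [mul_one_div, le_div_iff₀ hkm, one_mul]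
    exact le_add_of_nonneg_left (by positivity)
  · refine (hsecond hν0).trans ?_
    have : 0 ≤ c₁ := hB.trans hc₁B
    gcongr
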